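/- For $n\ge 1$ let $W_n=\sum_{i=1}^n |0\rangle^{\otimes (i-1)}\otimes|1\rangle\otimes|0\rangle^{\otimes(n-i)}\in(\mathbb C^2)^{\otimes n}$. For a tensor $T\in(\mathbb C^d)^{\otimes n}$ let: * $\mathrm{ti}(T)$ be the least $r$ such that $T=\sum_{\alpha_1,\dots,\alpha_n=1}^r |v_{\alpha_1,\alpha_2}\rangle\otimes|v_{\alpha_2,\alpha_3}\rangle\otimes\cdots\otimes|v_{\alpha_n,\alpha_1}\rangle$ for some vectors $|v_{\alpha,\beta}\rangle\in\mathbb C^d$ (the translationally invariant (t.i.) cyclic, or MPS, rank); * $\mathrm{ti}_+(T)$ be the least $r$ for which such vectors exist with nonnegative entries (t.i. nonnegative rank); * $\mathrm{ti}_{\rm psd}(T)$ be the least $r$ such that $T_{j_1,\dots,j_n}=\sum_{\alpha_i,\beta_i=1}^r (E_{j_1})_{\alpha_1,\alpha_2;\beta_1,\beta_2}\cdots(E_{j_n})_{\alpha_n,\alpha_1;\beta_n,\beta_1}$ for positive semidefinite complex $r^2\times r^2$ matrices $E_1,\dots,E_d$ (t.i. psd-rank). A rank is $\infty$ if no decomposition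 exists. For each of these ranks $R$, the border rank is $\underline R(T)=\lim_{\varepsilon\to0^+}\inf\{R(M):\|M-T\|<\varepsilon\}$. Then: 1. $\underline{\mathrm{ti}_+}(W_n)\le 2$ for every odd $n$; more generally $\underline{\mathrm{ti}_+}(W_n)\le p$ for all $n\ge1$ and $p\ge 2$ with $p\mid n-1$. Moreover, for $n,p\ge 2$ with $p\mid n-1$, let $A_0^\varepsilon=\varepsilon^{-1/(n-1)}P$ and $A_1^\varepsilon=\varepsilon I_p$, where $P$ is the $p\times p$ permutation matrix of the translation $i\mapsto i+1$ modulo $p$. Then the tensors with entries $\frac1p\,\mathrm{tr}(A_{j_1}^\varepsilon\cdots A_{j_n}^\varepsilon)$ equal $W_n+O(\varepsilon^2)$ as $\varepsilon\to0^+$. 2. $\sqrt n\le \mathrm{ti}(W_n)\le \mathrm{ti}_+(W_n)<\infty$ for every $n\ge 1$. In particular, for every odd $n\ge5$, $\underline{\mathrm{ti}_+}(W_n)=2<\mathrm{ti}(W_n)\le\mathrm{ti}_+(W_n)$. 3. $\underline{\mathrm{ti}_{\rm psd}}(W_n)=2$ for every $n\ge2$, while $n^{1/4}\le \mathrm{ti}_{\rm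 psd}(W_n)<\infty$ for every $n\ge 1$, so $\mathrm{ti}_{\rm psd}(W_n)=\Omega(n^{1/4})$. In particular, $\underline{\mathrm{ti}_{\rm psd}}(W_n)=2<3\le\mathrm{ti}_{\rm psd}(W_n)$ for every $n\ge17$. -/

import Mathlib

open scoped ENNReal Topology ComplexOrder

noncomputable section

namespace TICyclic

/-- Tensors in `(ℂ^d)^{⊗ n} ≅ ℂ^{d^n}`, given by their coefficients `T_{j_1, …, j_n}` in the
standard basis (basis vectors of `ℂ^d` are labelled `0, …, d - 1`). -/
abbrev Tensor (n d : ℕ) : Type := (Fin n → Fin d) → ℂ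

/-- The unnormalised W-state `|0…01⟩ + |0…10⟩ + … + |10…0⟩`. -/
def W (n : ℕ) : Tensor n 2 :=
  ∑ i : Fin n, Pi.single (Pi.single i (1 : Fin 2) : Fin n → Fin 2) (1 : ℂ)

/-- `v` is a translationally invariant cyclic (MPS) decomposition of `T` of bond dimension `r`:
`T = ∑_{α_1, …, α_n} |v_{α_1 α_2}⟩ ⊗ |v_{α_2 α_3}⟩ ⊗ ⋯ ⊗ |v_{α_n α_1}⟩`.
The permutation `finRotate n` is the cyclic shift `i ↦ i + 1` modulo `n`. -/
def IsTIDecomp {n d r : ℕ} (v : Fin r → Fin r → Fin d → ℂ) (T : Tensor n d) : Prop :=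
  ∀ j : Fin n → Fin d,
    T j = ∑ α : Fin n → Fin r, ∏ i : Fin n, v (α i) (α (finRotate n i)) (j i)

/-- `E` is a translationally invariant cyclic psd-decomposition of `T` of bond dimension `r`:
psd matrices `E_j` of size `r² × r²` with
`T_{j_1 … j_n} = ∑_{α, β} (E_{j_1})_{α_1 α_2; β_1 β_2} ⋯ (E_{j_n})_{α_n α_1; β_n β_1}`. -/
def IsTIPsdDecomp {n d r : ℕ} (E : Fin d → Matrix (Fin r × Fin r) (Fin r × Fin r) ℂ)
    (T : Tensor n d) : Prop :=
  (∀ j, (E j).PosSemidef) ∧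
  ∀ j : Fin n → Fin d,
    T j = ∑ α : Fin n → Fin r, ∑ β : Fin n → Fin r,
      ∏ i : Fin n, E (j i) (α i, α (finRotate n i)) (β i, β (finRotate n i))

/-- The t.i. (cyclic) rank; `⊤` if there is no decomposition. -/
def tiRank {n d : ℕ} (T : Tensor n d) : ℕ∞ :=
  ⨅ (r : ℕ) (_ : ∃ v : Fin r → Fin r → Fin d → ℂ, IsTIDecomp v T), (r : ℕ∞)

/-- The t.i. nonnegative (cyclic) rank: all local vectors are entrywise nonnegative reals
(`0 ≤ z` for complex `z` means that `z` is real and nonnegative). -/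
def tiNNRank {n d : ℕ} (T : Tensor n d) : ℕ∞ :=
  ⨅ (r : ℕ) (_ : ∃ v : Fin r → Fin r → Fin d → ℂ,
    (∀ a b j, 0 ≤ v a b j) ∧ IsTIDecomp v T), (r : ℕ∞)

/-- The t.i. (cyclic) psd-rank. -/
def tiPsdRank {n d : ℕ} (T : Tensor n d) : ℕ∞ :=
  ⨅ (r : ℕ) (_ : ∃ E : Fin d → Matrix (Fin r × Fin r) (Fin r × Fin r) ℂ,
    IsTIPsdDecomp E T), (r : ℕ∞)

/-- The `ε`-approximate version of a rank function. -/
def approxRank {n d : ℕ} (rk : Tensor n d → ℕ∞) (T : Tensor n d) (ε : ℝ) : ℕ∞ :=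
  ⨅ (M : Tensor n d) (_ : ‖M - T‖ < ε), rk M

/-- The border version of a rank function: the limit of `approxRank rk T ε` as `ε → 0⁺`.
As `approxRank rk T ε` grows when `ε` decreases, this limit is a supremum
(see `tendsto_approxRank`). -/
def borderRank {n d : ℕ} (rk : Tensor n d → ℕ∞) (T : Tensor n d) : ℕ∞ :=
  ⨆ (ε : ℝ) (_ : 0 < ε), approxRank rk T ε

theorem tendsto_approxRank {n d : ℕ} (rk : Tensor n d → ℕ∞) (T : Tensor n d) :
    Filter.Tendsto (approxRank rk T) (𝓝[>] 0) (𝓝 (borderRank rk T)) := by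
  have hanti : Antitone (approxRank rk T) := fun a b hab =>
    le_iInf₂ fun M hM => iInf₂_le (f := fun M (_ : ‖M - T‖ < b) => rk M) M (hM.trans_le hab)
  have h := hanti.tendsto_nhdsGT (0 : ℝ)
  have e : sSup (approxRank rk T '' Set.Ioi 0) = borderRank rk T := by
    rw [sSup_image]; rfl
  rwa [e] at h

/-- The `p × p` matrices `A_0^ε = ε^{-1/(n-1)} P` and `A_1^ε = ε I`, where `P` is the permutation
matrix of the cyclic translation. -/
def scaledPerm (n p : ℕ) (ε : ℝ) : Fin 2 → Matrix (Fin p) (Fin p) ℂ :=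
  ![((ε ^ (-1 / ((n : ℝ) - 1)) : ℝ) : ℂ) • (finRotate p).permMatrix ℂ,
    (ε : ℂ) • (1 : Matrix (Fin p) (Fin p) ℂ)]

/-- The tensor with entries `(1/p) tr (A_{j_1}^ε ⋯ A_{j_n}^ε)`. -/
def WApprox (n p : ℕ) (ε : ℝ) : Tensor n 2 := fun j =>
  (1 / (p : ℂ)) * (List.ofFn fun i : Fin n => scaledPerm n p ε (j i)).prod.trace

end TICyclic

end

/-! The hard point is the bound `n ≤ r ^ 2` for a t.i. decomposition of `W n` of bond dimension `r`.
Such a decomposition is a pair of `r × r` matrices `A`, `B` for which a word of length `n` has trace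
1 if it contains `B` exactly once and trace 0 otherwise. Suppose `n > r ^ 2`. Let `C` be the Drazin
inverse of `A`, `e = A * C` its spectral idempotent and `F k` the span of the words of length `k`
that contain `B`. The spaces `C ^ k * F k` form an increasing chain inside `e * Mat`, so they
stabilise, at a space `Q`, after `D = dim (e * Mat)` steps. The index `m` of `A` satisfies `D + m ≤
r ^ 2 ≤ n - 1`, which leaves room to pass between `Q` and honest words of length `n - 1` and `n`.
The space `I = Q * e` is then an algebra, possibly without unit, normalised by the unit `u` that is
`A` on the corner of `e` and the identity on the complement. The functional `x ↦ tr (u ^ n * x)`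
vanishes on products of elements of `I`, because words with two letters `B` have trace 0, and yet
equals `tr (A ^ (n - 1) * B) = 1` at `C * B * e ∈ I`. This contradicts `trace_pow_mul_eq_zero`:
modulo a nilpotent radical stable under conjugation by `u`, every element of `I` is a product of two
elements of `I`, and `u ^ n` times a radical element is nilpotent, hence of trace zero. The psd
bound follows, since a psd-decomposition of dimension `r` is an ordinary one of dimension `r ^ 2`.
The border ranks are small because commuting matrices suffice in the limit: the trace of a word then
depends only on its number `k` of letters `B`. Roots of unity (a cyclic permutation, or the signs of
a diagonal pair) kill the unwanted small `k`, and scaling kills the large ones. A border rank below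
2 is impossible because `W n` is not a limit of product tensors. -/

namespace TICyclic

/-! ### Traces twisted by a unit normalising a matrix algebra -/

section TwistedTrace

variable {r : ℕ}

/-- The left multiplier algebra of a subspace of matrices. -/
def leftMultiplier (I : Submodule ℂ (Matrix (Fin r) (Fin r) ℂ)) :
    Subalgebra ℂ (Matrix (Fin r) (Fin r) ℂ) where
  carrier := {X | ∀ x ∈ I, X * x ∈ I}
  mul_mem' {a b} ha hb x hx := by rw [mul_assoc]; exact ha _ (hb _ hx)
  add_mem' {a b} ha hb x hx := by rw [add_mul]; exact I.add_mem (ha _ hx) (hb _ hx)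
  algebraMap_mem' c x hx := by
    rw [← Algebra.smul_def]; exact I.smul_mem c hx

/-- The image in the matrix algebra of the Jacobson radical of the left multiplier algebra. -/
def multiplierRadical (I : Submodule ℂ (Matrix (Fin r) (Fin r) ℂ)) :
    Submodule ℂ (Matrix (Fin r) (Fin r) ℂ) :=
  ((Ring.jacobson (leftMultiplier I)).restrictScalars ℂ).map (leftMultiplier I).val.toLinearMap

theorem mem_multiplierRadical {I : Submodule ℂ (Matrix (Fin r) (Fin r) ℂ)}
    {X : Matrix (Fin r) (Fin r) ℂ} :
    X ∈ multiplierRadical I ↔ ∃ Y ∈ Ring.jacobson (leftMultiplier I), (Y : Matrix _ _ ℂ) = X :=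
  Iff.rfl

theorem conj_mem_leftMultiplier {I : Submodule ℂ (Matrix (Fin r) (Fin r) ℂ)}
    {u w : Matrix (Fin r) (Fin r) ℂ} (huw : u * w = 1)
    (hu : ∀ x ∈ I, u * x * w ∈ I) (hw : ∀ x ∈ I, w * x * u ∈ I)
    {X : Matrix (Fin r) (Fin r) ℂ} (hX : X ∈ leftMultiplier I) :
    u * X * w ∈ leftMultiplier I := by
  intro x hx
  have h2 := hu _ (hX _ (hw x hx))
  have e : u * (X * (w * x * u)) * w = u * X * w * x * (u * w) := by noncomm_ring
  rwa [e, huw, mul_one] at h2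

/-- Conjugation by `u` is a surjective ring endomorphism of the multiplier algebra, and such maps
preserve the Jacobson radical. -/
theorem conj_mem_multiplierRadical {I : Submodule ℂ (Matrix (Fin r) (Fin r) ℂ)}
    {u w : Matrix (Fin r) (Fin r) ℂ} (huw : u * w = 1) (hwu : w * u = 1)
    (hu : ∀ x ∈ I, u * x * w ∈ I) (hw : ∀ x ∈ I, w * x * u ∈ I)
    {X : Matrix (Fin r) (Fin r) ℂ} (hX : X ∈ multiplierRadical I) :
    u * X * w ∈ multiplierRadical I := by
  let f : leftMultiplier I →+* leftMultiplier I :=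
    { toFun := fun Y => ⟨u * Y * w, conj_mem_leftMultiplier huw hu hw Y.2⟩
      map_one' := by ext1; simp [huw]
      map_mul' := fun Y Z => by
        ext1
        have e : u * (Y : Matrix (Fin r) (Fin r) ℂ) * w * (u * Z * w)
          = u * Y * (w * u) * Z * w := by noncomm_ring
        rw [hwu, mul_one] at e
        exact (mul_assoc u (Y : Matrix (Fin r) (Fin r) ℂ) Z ▸ e).symm
      map_zero' := by ext1; simp
      map_add' := fun Y Z => by ext1; simp [mul_add, add_mul] }
  have hf : Function.Surjective f := by
    intro Y
    refine ⟨⟨_, conj_mem_leftMultiplier hwu hw hu Y.2⟩, ?_⟩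
    ext1
    have e : u * (w * (Y : Matrix (Fin r) (Fin r) ℂ) * u) * w = (u * w) * Y * (u * w) := by
      noncomm_ring
    exact e.trans (by rw [huw, one_mul, mul_one])
  have : RingHomSurjective f := ⟨hf⟩
  obtain ⟨Y, hY, rfl⟩ := mem_multiplierRadical.1 hX
  exact mem_multiplierRadical.2 ⟨f Y, Ring.le_comap_jacobson f hY, rfl⟩

theorem isNilpotent_multiplierRadical (I : Submodule ℂ (Matrix (Fin r) (Fin r) ℂ)) :
    IsNilpotent (multiplierRadical I) := by
  have : IsArtinianRing (leftMultiplier I) := IsArtinianRing.of_finite ℂ _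
  obtain ⟨k, hk⟩ := IsSemiprimaryRing.isNilpotent (R := leftMultiplier I)
  have key : ∀ l : ℕ, multiplierRadical I ^ l ≤
      (((Ring.jacobson (leftMultiplier I)) ^ l).restrictScalars ℂ).map
        (leftMultiplier I).val.toLinearMap := by
    intro l
    induction l with
    | zero =>
      rw [pow_zero, Submodule.one_le]
      exact ⟨1, by
        show _ ∈ Ring.jacobson (leftMultiplier I) ^ 0
        rw [Submodule.pow_zero, Ideal.one_eq_top]; exact Submodule.mem_top, by simp⟩
    | succ l ih =>
      rw [pow_succ, Submodule.mul_le]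
      intro a ha b hb
      obtain ⟨a', ha', rfl⟩ := ih ha
      obtain ⟨b', hb', rfl⟩ := hb
      exact ⟨a' * b', by
        show _ ∈ Ring.jacobson (leftMultiplier I) ^ (l + 1)
        rw [Submodule.pow_succ]; exact Ideal.mul_mem_mul ha' hb', by simp⟩
  refine ⟨k, le_bot_iff.1 ((key k).trans ?_)⟩
  rw [hk]
  rintro _ ⟨y, hy, rfl⟩
  have : y = 0 := by simpa using hy
  simp [this]

/-- Since conjugation by `u` preserves the radical, the line of `u` and the radical commute as
subspaces. A `k`-th power of `u ^ n * X` can therefore be collected into the `k`-th power of the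
radical, which is zero for large `k`. -/
theorem isNilpotent_pow_mul_of_mem_multiplierRadical
    {I : Submodule ℂ (Matrix (Fin r) (Fin r) ℂ)}
    {u w : Matrix (Fin r) (Fin r) ℂ} (huw : u * w = 1) (hwu : w * u = 1)
    (hu : ∀ x ∈ I, u * x * w ∈ I) (hw : ∀ x ∈ I, w * x * u ∈ I) (n : ℕ)
    {X : Matrix (Fin r) (Fin r) ℂ} (hX : X ∈ multiplierRadical I) :
    IsNilpotent (u ^ n * X) := by
  have hcomm : Commute (Submodule.span ℂ {u}) (multiplierRadical I) := by
    refine le_antisymm ?_ ?_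
    · rw [Submodule.mul_le]
      intro a ha b hb
      obtain ⟨c, rfl⟩ := Submodule.mem_span_singleton.1 ha
      have : c • u * b = (u * b * w) * (c • u) := by
        rw [mul_smul_comm, mul_assoc, hwu, mul_one, smul_mul_assoc]
      rw [this]
      exact Submodule.mul_mem_mul (conj_mem_multiplierRadical huw hwu hu hw hb) ha
    · rw [Submodule.mul_le]
      intro b hb a ha
      obtain ⟨c, rfl⟩ := Submodule.mem_span_singleton.1 ha
      have : b * c • u = (c • u) * (w * b * u) := by
        rw [smul_mul_assoc, ← mul_assoc, ← mul_assoc, huw, one_mul, mul_smul_comm]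
      rw [this]
      exact Submodule.mul_mem_mul ha (conj_mem_multiplierRadical hwu huw hw hu hb)
  obtain ⟨k, hk⟩ := isNilpotent_multiplierRadical I
  have hz : (Submodule.span ℂ {u} ^ n * multiplierRadical I) ^ k
      = 0 := by
    rw [(hcomm.pow_left n).mul_pow, hk, mul_zero]
  refine ⟨k, ?_⟩
  have h1 : u ^ n * X ∈
      Submodule.span ℂ {u} ^ n * multiplierRadical I :=
    Submodule.mul_mem_mul (Submodule.pow_mem_pow _ (Submodule.mem_span_singleton_self _) n) hX
  have h2 := Submodule.pow_mem_pow _ h1 k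
  rw [hz] at h2
  simpa using h2

/-- A trace twisted by a power of a unit normalising a matrix algebra `I` (not necessarily unital)
vanishes on `I` as soon as it vanishes on products. -/
theorem trace_pow_mul_eq_zero {I : Submodule ℂ (Matrix (Fin r) (Fin r) ℂ)}
    {u w : Matrix (Fin r) (Fin r) ℂ} (huw : u * w = 1) (hwu : w * u = 1)
    (hu : ∀ x ∈ I, u * x * w ∈ I) (hw : ∀ x ∈ I, w * x * u ∈ I)
    (hI : ∀ x ∈ I, ∀ y ∈ I, x * y ∈ I) (n : ℕ)
    (htr : ∀ x ∈ I, ∀ y ∈ I, (u ^ n * (x * y)).trace = 0)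
    {x : Matrix (Fin r) (Fin r) ℂ} (hx : x ∈ I) :
    (u ^ n * x).trace = 0 := by
  have : IsArtinianRing (leftMultiplier I) := IsArtinianRing.of_finite ℂ _
  let J := Ring.jacobson (leftMultiplier I)
  let I' : Ideal (leftMultiplier I) :=
    { carrier := {X | (X : Matrix (Fin r) (Fin r) ℂ) ∈ I}
      add_mem' := fun ha hb => I.add_mem ha hb
      zero_mem' := I.zero_mem
      smul_mem' := fun c y hy => c.2 _ hy }
  let π := Ideal.Quotient.mk J
  have hπ : Function.Surjective π := Ideal.Quotient.mk_surjective
  -- The quotient by the radical is semisimple, so the image of the left ideal `I'` is generated by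
  -- an idempotent. A lift `i ∈ I` of it acts as a right unit on `I` modulo the radical.
  obtain ⟨e, he, hspan⟩ := IsSemisimpleRing.ideal_eq_span_idempotent (I'.map π)
  have hemem : e ∈ I'.map π := by rw [hspan]; exact Ideal.mem_span_singleton_self e
  obtain ⟨i, hi, rfl⟩ := (Ideal.mem_map_iff_of_surjective π hπ).1 hemem
  let x' : leftMultiplier I := ⟨x, fun y hy => hI x hx y hy⟩
  have hx' : π x' ∈ I'.map π := Ideal.mem_map_of_mem π (show (x' : Matrix _ _ ℂ) ∈ I from hx)
  rw [hspan, Ideal.mem_span_singleton'] at hx'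
  obtain ⟨a, ha⟩ := hx'
  have hxi : π (x' - x' * i) = 0 := by
    rw [map_sub, map_mul, ← ha, mul_assoc, he.eq, sub_self]
  have hj : x' - x' * i ∈ J := Ideal.Quotient.eq_zero_iff_mem.1 hxi
  have hnil := isNilpotent_pow_mul_of_mem_multiplierRadical huw hwu hu hw n
    (mem_multiplierRadical.2 ⟨_, hj, rfl⟩)
  have h0 := (Matrix.isNilpotent_trace_of_isNilpotent hnil).eq_zero
  have h1 := htr x hx i hi
  have h2 : x = ((x' - x' * i : leftMultiplier I) : Matrix _ _ ℂ) + x * (i : Matrix _ _ ℂ) := by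
    simp [x']
  rw [h2, mul_add, Matrix.trace_add, h0, h1, add_zero]

end TwistedTrace

end TICyclic

/-! ### Stabilisation of chains of subspaces, and the Drazin inverse -/

namespace TICyclic

/-- The iterates from the bottom of a monotone map on subspaces, when they all lie in a subspace
of dimension `d`, are constant after `d` steps. -/
theorem iterate_bot_eq_of_finrank_le {K V : Type*} [DivisionRing K] [AddCommGroup V] [Module K V]
    [FiniteDimensional K V] {Φ : Submodule K V → Submodule K V} (hΦ : Monotone Φ) {d : ℕ}
    (hd : ∀ k, Module.finrank K (Φ^[k] ⊥ : Submodule K V) ≤ d) {k : ℕ} (hk : d ≤ k) :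
    Φ^[k] ⊥ = Φ^[d] ⊥ := by
  have hstep : ∀ k, Φ^[k] ⊥ ≤ Φ^[k + 1] ⊥ := fun k => by
    rw [Function.iterate_succ_apply]
    exact hΦ.iterate k bot_le
  have hstab : ∀ k l, Φ^[k] ⊥ = Φ^[k + 1] ⊥ → k ≤ l → Φ^[l] ⊥ = Φ^[k] ⊥ := by
    intro k l h hl
    induction l, hl using Nat.le_induction with
    | base => rfl
    | succ l _ ih => rw [Function.iterate_succ_apply', ih, ← Function.iterate_succ_apply' Φ, ← h]
  have hor : ∀ k, Φ^[k] ⊥ = Φ^[k + 1] ⊥ ∨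
      k + 1 ≤ Module.finrank K (Φ^[k + 1] ⊥ : Submodule K V) := by
    intro k
    by_cases h : Φ^[k] ⊥ = Φ^[k + 1] ⊥
    · exact Or.inl h
    right
    have hlt := Submodule.finrank_lt_finrank_of_lt (lt_of_le_of_ne (hstep k) h)
    induction k with
    | zero => omega
    | succ k ih =>
      have h' : ¬ Φ^[k] ⊥ = Φ^[k + 1] ⊥ := fun e => h <|
        (hstab k _ e (Nat.le_succ k)).trans (hstab k (k + 2) e (by omega)).symm
      have := ih h' (Submodule.finrank_lt_finrank_of_lt (lt_of_le_of_ne (hstep k) h'))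
      omega
  rcases hor d with h | h
  · exact hstab d k h hk
  · exact absurd (h.trans (hd _)) (by omega)

section Drazin

variable {r : ℕ}

/-- The matrices fixed by left multiplication with `e`. -/
def leftFixed (e : Matrix (Fin r) (Fin r) ℂ) : Submodule ℂ (Matrix (Fin r) (Fin r) ℂ) where
  carrier := {X | e * X = X}
  add_mem' {a b} ha hb := by
    simp only [Set.mem_ofPred_eq] at ha hb ⊢
    rw [mul_add, ha, hb]
  zero_mem' := mul_zero e
  smul_mem' c x hx := by
    simp only [Set.mem_ofPred_eq] at hx ⊢
    rw [mul_smul_comm, hx]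

/-- A nonzero row vector `φ` with `φ * A = 0` also kills every `X = A * C * X`. These are `r`
independent linear conditions on `X`. -/
theorem finrank_leftFixed_add_le {A C : Matrix (Fin r) (Fin r) ℂ} (hA : ¬ IsUnit A) :
    Module.finrank ℂ (leftFixed (A * C)) + r ≤ r ^ 2 := by
  have hdet : A.det = 0 := by
    by_contra h
    exact hA ((Matrix.isUnit_iff_isUnit_det A).2 (isUnit_iff_ne_zero.2 h))
  obtain ⟨φ, hφ, hφA⟩ := Matrix.exists_vecMul_eq_zero_iff.2 hdet
  obtain ⟨i, hi⟩ := Function.ne_iff.1 hφ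
  let f : Matrix (Fin r) (Fin r) ℂ →ₗ[ℂ] (Fin r → ℂ) :=
    { toFun := fun X => Matrix.vecMul φ X
      map_add' := fun X Y => Matrix.vecMul_add X Y φ
      map_smul' := fun c X => by simp [Matrix.vecMul_smul] }
  have hf : LinearMap.range f = ⊤ := by
    rw [LinearMap.range_eq_top]
    intro v
    refine ⟨Matrix.of fun a b => if a = i then (φ i)⁻¹ * v b else 0, ?_⟩
    ext b
    have hi' : φ i ≠ 0 := hi
    simp [f, Matrix.vecMul, dotProduct, hi']
  have hle : leftFixed (A * C) ≤ LinearMap.ker f := by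
    intro X hX
    have hX' : A * C * X = X := hX
    show Matrix.vecMul φ X = 0
    rw [← hX', ← Matrix.vecMul_vecMul, ← Matrix.vecMul_vecMul, hφA]
    simp
  have h1 := Submodule.finrank_mono hle
  have h2 := LinearMap.finrank_range_add_finrank_ker f
  rw [hf, finrank_top, Module.finrank_fin_fun, Module.finrank_matrix] at h2
  simp only [Fintype.card_fin, Module.finrank_self, mul_one] at h2
  rw [sq]
  omega

/-- Every square matrix has a Drazin inverse `C`; the index `m` is controlled by the dimension of
the corner cut out by the spectral idempotent `A * C`. -/
theorem exists_drazin_inverse (A : Matrix (Fin r) (Fin r) ℂ) :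
    ∃ (m : ℕ) (C : Matrix (Fin r) (Fin r) ℂ), A * C = C * A ∧ C * A * C = C ∧
      A ^ m * (A * C) = A ^ m ∧ Module.finrank ℂ (leftFixed (A * C)) + m ≤ r ^ 2 := by
  by_cases hA : IsUnit A
  · obtain ⟨u, rfl⟩ := hA
    refine ⟨0, ((u⁻¹ : (Matrix (Fin r) (Fin r) ℂ)ˣ) : Matrix (Fin r) (Fin r) ℂ), ?_, ?_, ?_, ?_⟩
    · rw [Units.mul_inv, Units.inv_mul]
    · rw [Units.inv_mul, one_mul]
    · rw [Units.mul_inv, mul_one]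
    · refine (Submodule.finrank_le _).trans ?_
      simp [Module.finrank_matrix, sq]
  · obtain ⟨q, hq, hnd⟩ := Polynomial.exists_eq_pow_rootMultiplicity_mul_and_not_dvd
      A.charpoly (Matrix.charpoly_monic A).ne_zero 0
    rw [Polynomial.C_0, sub_zero] at hq hnd
    set k := A.charpoly.rootMultiplicity 0
    have hk : k ≤ r := by
      have h1 := Polynomial.natDegree_le_of_dvd (Dvd.intro q hq.symm)
        (Matrix.charpoly_monic A).ne_zero
      rw [Polynomial.natDegree_X_pow, Matrix.charpoly_natDegree_eq_dim, Fintype.card_fin] at h1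
      exact h1
    -- The Bézout relation `a * X ^ (r + 1) + b * q = 1` gives the candidate `C = a(A) * A ^ r`. The
    -- product `A * C` is then the projection onto the part where `A` is invertible, because `A ^ r
    -- * q(A) = 0` by Cayley–Hamilton.
    have hcop : IsCoprime ((Polynomial.X : Polynomial ℂ) ^ (r + 1)) q :=
      ((Polynomial.irreducible_X).coprime_iff_not_dvd.2 hnd).pow_left
    obtain ⟨a, b, hab⟩ := hcop
    have hz : A ^ r * Polynomial.aeval A q = 0 := by
      have h1 := Matrix.aeval_self_charpoly A
      rw [hq, map_mul, map_pow, Polynomial.aeval_X] at h1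
      have h2 : A ^ r = A ^ (r - k) * A ^ k := by rw [← pow_add, Nat.sub_add_cancel hk]
      rw [h2, mul_assoc, h1, mul_zero]
    have hab' := congrArg (Polynomial.aeval A) hab
    simp only [map_add, map_mul, map_pow, Polynomial.aeval_X, map_one] at hab'
    set a' := Polynomial.aeval A a
    set b' := Polynomial.aeval A b
    have ca : A * a' = a' * A := by
      have := congrArg (Polynomial.aeval A) (mul_comm Polynomial.X a)
      simpa using this
    have caP : ∀ l, A ^ l * a' = a' * A ^ l := fun l =>
      Commute.pow_left (show Commute A a' from ca) l
    have cb : A ^ r * b' = b' * A ^ r := by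
      have := congrArg (Polynomial.aeval A) (mul_comm (Polynomial.X ^ r) b)
      simpa using this
    have hAe : A ^ r * (a' * A ^ (r + 1)) = A ^ r := by
      have h1 : A ^ r * (a' * A ^ (r + 1) + b' * Polynomial.aeval A q) = A ^ r := by
        rw [hab', mul_one]
      have h2 : A ^ r * (b' * Polynomial.aeval A q) = 0 := by
        rw [← mul_assoc, cb, mul_assoc, hz, mul_zero]
      rwa [mul_add, h2, add_zero] at h1
    have hAC : A * (a' * A ^ r) = a' * A ^ (r + 1) := by
      rw [← mul_assoc, ca, mul_assoc, pow_succ']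
    -- The crude index `m = r` is enough, because a singular `A` makes the corner lose at least `r`
    -- dimensions.
    refine ⟨r, a' * A ^ r, ?_, ?_, ?_, finrank_leftFixed_add_le hA⟩
    · rw [hAC, pow_succ, mul_assoc]
    · have h1 : a' * A ^ r * A = a' * A ^ (r + 1) := by rw [mul_assoc, ← pow_succ]
      rw [h1, mul_assoc a', ← mul_assoc _ a', caP, mul_assoc, ← pow_add, add_comm (r + 1),
        pow_add, ← mul_assoc a' (A ^ r), ← caP r, mul_assoc, hAe, caP]
    · rw [hAC, hAe]

end Drazin

end TICyclic

/-! ### Spans of words containing the letter `B` -/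

namespace TICyclic

section WordSpan

variable {r : ℕ} (A B : Matrix (Fin r) (Fin r) ℂ)

/-- The span of all words of length `k` in `A` and `B` that contain the letter `B`. -/
def wordSpan : ℕ → Submodule ℂ (Matrix (Fin r) (Fin r) ℂ)
  | 0 => ⊥
  | k + 1 => wordSpan k * Submodule.span ℂ {A, B} ⊔ Submodule.span ℂ {A ^ k * B}

theorem wordSpan_succ (k : ℕ) : wordSpan A B (k + 1) =
    wordSpan A B k * Submodule.span ℂ {A, B} ⊔ Submodule.span ℂ {A ^ k * B} := rfl

/-- To prove a linear property on `wordSpan`, it suffices to check the right recursion. -/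
theorem wordSpan_induction {P : ℕ → Submodule ℂ (Matrix (Fin r) (Fin r) ℂ)}
    (hA : ∀ k, ∀ x ∈ P k, x * A ∈ P (k + 1)) (hB : ∀ k, ∀ x ∈ P k, x * B ∈ P (k + 1))
    (h1 : ∀ k, A ^ k * B ∈ P (k + 1)) (k : ℕ) : wordSpan A B k ≤ P k := by
  induction k with
  | zero => exact bot_le
  | succ k ih =>
    rw [wordSpan_succ, sup_le_iff, Submodule.span_singleton_le_iff_mem]
    refine ⟨?_, h1 k⟩
    rw [Submodule.mul_le]
    intro x hx y hy
    rw [Submodule.mem_span_pair] at hy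
    obtain ⟨a, b, rfl⟩ := hy
    rw [mul_add, mul_smul_comm, mul_smul_comm]
    exact (P (k + 1)).add_mem ((P (k + 1)).smul_mem _ (hA k x (ih hx)))
      ((P (k + 1)).smul_mem _ (hB k x (ih hx)))

variable {A B}

theorem mem_span_pair_left : A ∈ Submodule.span ℂ {A, B} := Submodule.subset_span (by simp)

theorem mem_span_pair_right : B ∈ Submodule.span ℂ {A, B} := Submodule.subset_span (by simp)

theorem wordSpan_le_pow (k : ℕ) : wordSpan A B k ≤ Submodule.span ℂ {A, B} ^ k := by
  refine wordSpan_induction A B (P := fun k => Submodule.span ℂ {A, B} ^ k) ?_ ?_ ?_ k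
  · intro k x hx
    rw [pow_succ]
    exact Submodule.mul_mem_mul hx mem_span_pair_left
  · intro k x hx
    rw [pow_succ]
    exact Submodule.mul_mem_mul hx mem_span_pair_right
  · intro k
    rw [pow_succ]
    exact Submodule.mul_mem_mul (Submodule.pow_mem_pow _ mem_span_pair_left k) mem_span_pair_right

theorem mul_mem_wordSpan {k : ℕ} {x : Matrix (Fin r) (Fin r) ℂ} (hx : x ∈ wordSpan A B k) :
    A * x ∈ wordSpan A B (k + 1) := by
  refine wordSpan_induction A B
    (P := fun k => (wordSpan A B (k + 1)).comap (LinearMap.mulLeft ℂ A)) ?_ ?_ ?_ k hx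
  · intro k x hx
    simp only [Submodule.mem_comap, LinearMap.mulLeft_apply] at hx ⊢
    rw [← mul_assoc, wordSpan_succ]
    exact Submodule.mem_sup_left (Submodule.mul_mem_mul hx mem_span_pair_left)
  · intro k x hx
    simp only [Submodule.mem_comap, LinearMap.mulLeft_apply] at hx ⊢
    rw [← mul_assoc, wordSpan_succ]
    exact Submodule.mem_sup_left (Submodule.mul_mem_mul hx mem_span_pair_right)
  · intro k
    simp only [Submodule.mem_comap, LinearMap.mulLeft_apply]
    rw [← mul_assoc, ← pow_succ', wordSpan_succ]
    exact Submodule.mem_sup_right (Submodule.mem_span_singleton_self _)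

theorem pow_mul_mem_wordSpan {k : ℕ} {x : Matrix (Fin r) (Fin r) ℂ} (hx : x ∈ wordSpan A B k)
    (m : ℕ) : A ^ m * x ∈ wordSpan A B (k + m) := by
  induction m with
  | zero => simpa using hx
  | succ m ih => rw [pow_succ', mul_assoc]; exact mul_mem_wordSpan ih

/-- Each word is split at its last `B`. Under a trace this letter can then be rotated to the front.
-/
theorem wordSpan_le_span (k : ℕ) : wordSpan A B k ≤ Submodule.span ℂ
    {x | ∃ a b, a + b + 1 = k ∧ ∃ w ∈ Submodule.span ℂ {A, B} ^ a, x = w * B * A ^ b} := by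
  refine wordSpan_induction A B (P := fun k => Submodule.span ℂ
    {x | ∃ a b, a + b + 1 = k ∧ ∃ w ∈ Submodule.span ℂ {A, B} ^ a, x = w * B * A ^ b}) ?_ ?_ ?_ k
  · intro k x hx
    induction hx using Submodule.span_induction with
    | mem x hx =>
      obtain ⟨a, b, rfl, w, hw, rfl⟩ := hx
      exact Submodule.subset_span ⟨a, b + 1, by omega, w, hw, by rw [pow_succ, mul_assoc _ _ A]⟩
    | zero => rw [zero_mul]; exact Submodule.zero_mem _
    | add x y _ _ hx hy => rw [add_mul]; exact Submodule.add_mem _ hx hy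
    | smul c x _ hx => rw [smul_mul_assoc]; exact Submodule.smul_mem _ _ hx
  · intro k x hx
    induction hx using Submodule.span_induction with
    | mem x hx =>
      obtain ⟨a, b, rfl, w, hw, rfl⟩ := hx
      refine Submodule.subset_span ⟨a + b + 1, 0, by omega, w * B * A ^ b, ?_, by simp⟩
      have := Submodule.mul_mem_mul (Submodule.mul_mem_mul hw
        (mem_span_pair_right (A := A) (B := B)))
        (Submodule.pow_mem_pow _ (mem_span_pair_left (A := A) (B := B)) b)
      rwa [← pow_succ, ← pow_add, add_right_comm] at this
    | zero => rw [zero_mul]; exact Submodule.zero_mem _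
    | add x y _ _ hx hy => rw [add_mul]; exact Submodule.add_mem _ hx hy
    | smul c x _ hx => rw [smul_mul_assoc]; exact Submodule.smul_mem _ _ hx
  · intro k
    exact Submodule.subset_span ⟨k, 0, by omega, A ^ k,
      Submodule.pow_mem_pow _ mem_span_pair_left k, by simp⟩

theorem wordSpan_le_span_prod (k : ℕ) : wordSpan A B k ≤ Submodule.span ℂ
    {x | ∃ l : List (Fin 2), l.length = k ∧ 1 ≤ l.count 1 ∧ x = (l.map ![A, B]).prod} := by
  refine wordSpan_induction A B (P := fun k => Submodule.span ℂ
    {x | ∃ l : List (Fin 2), l.length = k ∧ 1 ≤ l.count 1 ∧ x = (l.map ![A, B]).prod}) ?_ ?_ ?_ k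
  · intro k x hx
    induction hx using Submodule.span_induction with
    | mem x hx =>
      obtain ⟨l, rfl, h1, rfl⟩ := hx
      exact Submodule.subset_span ⟨l ++ [0], by simp, by rw [List.count_append]; omega, by simp⟩
    | zero => rw [zero_mul]; exact Submodule.zero_mem _
    | add x y _ _ hx hy => rw [add_mul]; exact Submodule.add_mem _ hx hy
    | smul c x _ hx => rw [smul_mul_assoc]; exact Submodule.smul_mem _ _ hx
  · intro k x hx
    induction hx using Submodule.span_induction with
    | mem x hx =>
      obtain ⟨l, rfl, h1, rfl⟩ := hx
      exact Submodule.subset_span ⟨l ++ [1], by simp, by rw [List.count_append]; omega, by simp⟩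
    | zero => rw [zero_mul]; exact Submodule.zero_mem _
    | add x y _ _ hx hy => rw [add_mul]; exact Submodule.add_mem _ hx hy
    | smul c x _ hx => rw [smul_mul_assoc]; exact Submodule.smul_mem _ _ hx
  · intro k
    exact Submodule.subset_span ⟨List.replicate k 0 ++ [1], by simp, by simp, by simp⟩

end WordSpan

/-! ### The bound `n ≤ r ^ 2` for two matrices -/

section Core

variable {r : ℕ} {A B C : Matrix (Fin r) (Fin r) ℂ}

theorem pow_mul_pow_mul_eq_self {X Y x : Matrix (Fin r) (Fin r) ℂ} (hXY : Commute X Y)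
    (h : X * Y * x = x) (k : ℕ) : X ^ k * (Y ^ k * x) = x := by
  rw [← mul_assoc, ← hXY.mul_pow]
  induction k with
  | zero => simp
  | succ k ih => rw [pow_succ, mul_assoc, h, ih]

theorem mul_pow_mul_pow_eq_self {X Y x : Matrix (Fin r) (Fin r) ℂ} (hXY : Commute X Y)
    (h : x * (X * Y) = x) (k : ℕ) : x * X ^ k * Y ^ k = x := by
  rw [mul_assoc, ← hXY.mul_pow]
  induction k with
  | zero => simp
  | succ k ih => rw [pow_succ', ← mul_assoc, h, ih]

/-- The subspaces `C ^ k * wordSpan A B k` are the iterates of a monotone map. -/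
theorem iterate_eq_span_pow_mul_wordSpan (hAC : Commute A C) (hC : C * A * C = C) (k : ℕ) :
    (fun Q : Submodule ℂ (Matrix (Fin r) (Fin r) ℂ) =>
      Submodule.span ℂ {C} * Q * Submodule.span ℂ {A, B} ⊔
      Submodule.span ℂ {C * B})^[k] ⊥ = Submodule.span ℂ {C ^ k} * wordSpan A B k := by
  induction k with
  | zero => simp [wordSpan]
  | succ k ih =>
    have h1 : C ^ (k + 1) * (A ^ k * B) = C * B := by
      have : C * A * (C * B) = C * B := by rw [← mul_assoc, hC]
      rw [← pow_mul_pow_mul_eq_self hAC.symm this k, pow_succ, mul_assoc, ← mul_assoc C,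
        ← (hAC.pow_left k).eq, mul_assoc]
    rw [Function.iterate_succ_apply', ih, wordSpan_succ, Submodule.mul_sup,
      Submodule.span_mul_span ℂ {C ^ (k + 1)} {A ^ k * B}, Set.singleton_mul_singleton, h1,
      pow_succ', ← Set.singleton_mul_singleton (a := C) (b := C ^ k), ← Submodule.span_mul_span]
    simp only [mul_assoc]

/-- If the words of length `n` in two `r × r` matrices have the traces of the W-state,
then `n ≤ r ^ 2`. -/
theorem le_sq_of_trace_words {n : ℕ} (h1 : (A ^ (n - 1) * B).trace = 1)
    (h2 : ∀ x ∈ wordSpan A B (n - 1), (B * x).trace = 0) : n ≤ r ^ 2 := by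
  by_contra! hn
  obtain ⟨m, C, hAC, hC, hm, hfr⟩ := exists_drazin_inverse A
  have cAC : Commute A C := hAC
  obtain ⟨e, he⟩ : ∃ e, e = A * C := ⟨_, rfl⟩
  rw [← he] at hm hfr
  set D := Module.finrank ℂ (leftFixed e)
  have hCA : C * A = e := by rw [he, hAC]
  have heC : e * C = C := by rw [← hCA, hC]
  have hCe : C * e = C := by rw [he, ← mul_assoc, hC]
  have hee : e * e = e := by rw [he, mul_assoc, ← mul_assoc C, hC]
  have heA : e * A = A * e := by rw [he, mul_assoc, ← hAC]
  have hmk : ∀ k, A ^ m * (A ^ k * C ^ k) = A ^ m := fun k => by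
    rw [← mul_assoc]; exact mul_pow_mul_pow_eq_self cAC (by rw [← he, hm]) k
  have hm' : e * A ^ m = A ^ m := by
    rw [((show Commute e A from heA).pow_right m).eq, hm]
  -- One step of `Φ` appends a letter on the right and cancels one `A` on the left, so the iterates
  -- normalise words of all lengths into one fixed corner, where their dimensions are bounded by
  -- `D`.
  let Φ : Submodule ℂ (Matrix (Fin r) (Fin r) ℂ) → Submodule ℂ (Matrix (Fin r) (Fin r) ℂ) :=
    fun Q => Submodule.span ℂ {C} * Q * Submodule.span ℂ {A, B} ⊔ Submodule.span ℂ {C * B}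
  have hΦ : Monotone Φ := fun P Q hPQ =>
    sup_le_sup_right (mul_le_mul_left (mul_le_mul_right hPQ _) _) _
  have hiter : ∀ k, Φ^[k] ⊥ = Submodule.span ℂ {C ^ k} * wordSpan A B k :=
    iterate_eq_span_pow_mul_wordSpan cAC hC
  have hfix : ∀ k, Φ^[k] ⊥ ≤ leftFixed e := by
    intro k
    cases k with
    | zero => exact bot_le
    | succ k =>
      rw [hiter, Submodule.mul_le]
      intro x hx y _
      obtain ⟨c, rfl⟩ := Submodule.mem_span_singleton.1 hx
      show e * _ = _
      rw [← mul_assoc, mul_smul_comm, pow_succ', ← mul_assoc e, heC]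
  have hstable : ∀ k, D ≤ k → Φ^[k] ⊥ = Φ^[D] ⊥ := fun k hk =>
    iterate_bot_eq_of_finrank_le hΦ (fun k => Submodule.finrank_mono (hfix k)) hk
  set Q := Φ^[D] ⊥ with hQ
  have hΦQ : Φ Q = Q := by
    rw [hQ, ← Function.iterate_succ_apply' Φ, hstable (D + 1) (Nat.le_succ D)]
  have hQmul : ∀ q ∈ Q, ∀ l ∈ Submodule.span ℂ {A, B}, C * q * l ∈ Q := by
    intro q hq l hl
    rw [← hΦQ]
    exact Submodule.mem_sup_left (Submodule.mul_mem_mul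
      (Submodule.mul_mem_mul (Submodule.mem_span_singleton_self C) hq) hl)
  have hCB : C * B ∈ Q := by
    rw [← hΦQ]
    exact Submodule.mem_sup_right (Submodule.mem_span_singleton_self _)
  have heQ : ∀ q ∈ Q, e * q = q := fun q hq => hfix D hq
  have hQF : ∀ k, D ≤ k → ∀ q ∈ Q, ∃ f ∈ wordSpan A B k, q = C ^ k * f := by
    intro k hk q hq
    rw [← hstable k hk, hiter, Submodule.mem_span_singleton_mul] at hq
    obtain ⟨f, hf, rfl⟩ := hq
    exact ⟨f, hf, rfl⟩
  have hQpow : ∀ k, ∀ l ∈ Submodule.span ℂ {A, B} ^ k, ∀ q ∈ Q, C ^ k * q * l ∈ Q := by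
    intro k
    induction k with
    | zero =>
      intro l hl q hq
      rw [pow_zero, Submodule.mem_one] at hl
      obtain ⟨c, rfl⟩ := hl
      rw [pow_zero, one_mul, ← Algebra.commutes, ← Algebra.smul_def]
      exact Q.smul_mem c hq
    | succ k ih =>
      intro l hl q hq
      rw [pow_succ'] at hl
      refine Submodule.mul_induction_on hl (fun a ha b hb => ?_) (fun a b ha hb => ?_)
      · have := ih b hb _ (hQmul q hq a ha)
        rw [pow_succ]
        simpa only [mul_assoc] using this
      · rw [mul_add]; exact Q.add_mem ha hb
  let I : Submodule ℂ (Matrix (Fin r) (Fin r) ℂ) := Q.map (LinearMap.mulRight ℂ e)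
  have hImem : ∀ q ∈ Q, q * e ∈ I := fun q hq => ⟨q, hq, rfl⟩
  have heI : ∀ x ∈ I, e * x = x := by
    rintro _ ⟨q, hq, rfl⟩
    simp only [LinearMap.mulRight_apply]
    rw [← mul_assoc, heQ q hq]
  have hIe : ∀ x ∈ I, x * e = x := by
    rintro _ ⟨q, hq, rfl⟩
    simp only [LinearMap.mulRight_apply]
    rw [mul_assoc, hee]
  have hCIA : ∀ x ∈ I, C * x * A ∈ I := by
    rintro _ ⟨q, hq, rfl⟩
    simp only [LinearMap.mulRight_apply]
    have : C * (q * e) * A = (C * q * A) * e := by simp only [mul_assoc, heA]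
    rw [this]
    exact hImem _ (hQmul q hq A mem_span_pair_left)
  have hAIC : ∀ x ∈ I, A * x * C ∈ I := by
    -- The map `x ↦ C * x * A` is injective on the finite-dimensional `I`, hence bijective, so its
    -- inverse `x ↦ A * x * C` also preserves `I`.
    let ψ : I →ₗ[ℂ] I :=
      ((LinearMap.mulRight ℂ A).comp (LinearMap.mulLeft ℂ C)).restrict hCIA
    have hinv : ∀ y : I, A * (ψ y : Matrix (Fin r) (Fin r) ℂ) * C = y := by
      intro y
      have : A * (C * (y : Matrix (Fin r) (Fin r) ℂ) * A) * C = e * (y * e) := by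
        simp only [he, mul_assoc]
      exact this.trans (by rw [hIe y y.2, heI y y.2])
    have hinj : Function.Injective ψ := by
      intro y z hyz
      ext1
      rw [← hinv y, ← hinv z, hyz]
    intro x hx
    obtain ⟨y, hy⟩ := LinearMap.injective_iff_surjective.1 hinj ⟨x, hx⟩
    have := hinv y
    rw [hy] at this
    exact this ▸ y.2
  have hAICpow : ∀ k, ∀ x ∈ I, A ^ k * x * C ^ k ∈ I := by
    intro k
    induction k with
    | zero => intro x hx; simpa using hx
    | succ k ih =>
      intro x hx
      have := hAIC _ (ih x hx)
      rw [pow_succ', pow_succ]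
      simpa only [mul_assoc] using this
  have hIQ : ∀ k, ∀ x ∈ I, ∀ l ∈ Submodule.span ℂ {A, B} ^ k, C ^ k * x * l ∈ Q := by
    intro k x hx l hl
    obtain ⟨q, hq, hqe⟩ := hAICpow m x hx
    simp only [LinearMap.mulRight_apply] at hqe
    -- Putting `A ^ m` on the right of `e` lets `e` be dropped, as `e * A ^ m = A ^ m`. What remains
    -- is `q ∈ Q` times a word, which `hQpow` handles.
    have hx' : x = C ^ m * (q * e) * A ^ m := by
      have p1 : C ^ m * (A ^ m * x) = x :=
        pow_mul_pow_mul_eq_self cAC.symm (by rw [hCA, heI x hx]) m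
      have p2 : x * C ^ m * A ^ m = x :=
        mul_pow_mul_pow_eq_self cAC.symm (by rw [hCA, hIe x hx]) m
      rw [hqe, ← mul_assoc (C ^ m), p1, p2]
    have h3 : C ^ k * x * l = C ^ (k + m) * q * (A ^ m * l) := by
      have p1 : C ^ k * (C ^ m * (q * e) * A ^ m) * l = C ^ k * C ^ m * q * (e * A ^ m * l) := by
        simp only [mul_assoc]
      rw [hx', p1, hm', ← pow_add]
    rw [h3]
    refine hQpow (k + m) _ ?_ q hq
    rw [add_comm, pow_add]
    exact Submodule.mul_mem_mul (Submodule.pow_mem_pow _ mem_span_pair_left m) hl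
  have hII : ∀ x ∈ I, ∀ y ∈ I, x * y ∈ I := by
    rintro x hx _ ⟨q, hq, rfl⟩
    simp only [LinearMap.mulRight_apply]
    obtain ⟨f, hf, rfl⟩ := hQF D le_rfl q hq
    -- Moving `C ^ D` to the left across `x` costs a conjugation by `A ^ D`, under which `I` is
    -- stable.
    have h3 : x * (C ^ D * f * e) = C ^ D * (A ^ D * x * C ^ D) * f * e := by
      have : C ^ D * (A ^ D * x) = x := pow_mul_pow_mul_eq_self cAC.symm
        (by rw [hCA, heI x hx]) D
      rw [← mul_assoc (C ^ D) (A ^ D * x), this]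
      simp only [mul_assoc]
    rw [h3]
    exact hImem _ (hIQ D _ (hAICpow D x hx) f (wordSpan_le_pow D hf))
  let u := A * e + (1 - e)
  let w := C + (1 - e)
  have huw : u * w = 1 := by
    have : u * w = A * (e * C) + (A * e - A * (e * e)) + (C - e * C) + (1 - e - e + e * e) := by
      simp only [u, w]; noncomm_ring
    rw [this, heC, hee, ← he]; abel
  have hwu : w * u = 1 := by
    have : w * u = C * A * e + (C - C * e) + (A * e - e * A * e) + (1 - e - e + e * e) := by
      simp only [u, w]; noncomm_ring
    rw [this, hCA, hCe, heA, mul_assoc A, hee]; abel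
  have hux : ∀ x, e * x = x → u * x = A * x := by
    intro x hx
    simp only [u]
    rw [add_mul, sub_mul, one_mul, mul_assoc, hx, sub_self, add_zero]
  have hxw : ∀ x, x * e = x → x * w = x * C := by
    intro x hx
    simp only [w]
    rw [mul_add, mul_sub, mul_one, hx, sub_self, add_zero]
  have hxu : ∀ x, x * e = x → x * u = x * A := by
    intro x hx
    simp only [u]
    rw [mul_add, mul_sub, mul_one, hx, sub_self, add_zero, ← heA, ← mul_assoc, hx]
  have hwx : ∀ x, e * x = x → w * x = C * x := by
    intro x hx
    simp only [w]
    rw [add_mul, sub_mul, one_mul, hx, sub_self, add_zero]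
  have hupow : ∀ k x, e * x = x → u ^ k * x = A ^ k * x := by
    intro k
    induction k with
    | zero => simp
    | succ k ih =>
      intro x hx
      rw [pow_succ, pow_succ, mul_assoc, hux x hx, ih _ (by rw [← mul_assoc, heA, mul_assoc, hx]),
        mul_assoc]
  have hDn : D + m ≤ n - 1 := by omega
  have htrF : ∀ f ∈ wordSpan A B n, ∀ y ∈ I, (f * y).trace = 0 := by
    intro f hf y hy
    replace hf := wordSpan_le_span n hf
    induction hf using Submodule.span_induction with
    | mem f hf =>
      obtain ⟨a, b, hab, w, hw, rfl⟩ := hf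
      -- Here `y * w = A ^ a * (C ^ a * y * w)`, and the bracket lies in `Q`, hence is `C ^ (n - 1 -
      -- m) * g` with `g` a combination of words of length `n - 1 - m ≥ D`. As `a + b = n - 1`, the
      -- powers combine to `A ^ m * g`: the last `m` factors `A` absorb the idempotent.
      have h3 : A ^ b * y * w ∈ wordSpan A B (n - 1) := by
        obtain ⟨g, hg, hg'⟩ := hQF (n - 1 - m) (by omega) _ (hIQ a y hy w hw)
        have h4 : A ^ b * y * w = A ^ m * g := by
          have h5 : y * w = A ^ a * (C ^ a * y * w) := by
            rw [mul_assoc (C ^ a), pow_mul_pow_mul_eq_self cAC]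
            rw [← he, ← mul_assoc, heI y hy]
          rw [mul_assoc, h5, hg', ← mul_assoc, ← mul_assoc, ← pow_add,
            show b + a = m + (n - 1 - m) by omega, pow_add, mul_assoc (A ^ m), hmk]
        rw [h4]
        have := pow_mul_mem_wordSpan hg m
        rwa [Nat.sub_add_cancel (by omega)] at this
      have h5 := h2 _ h3
      rw [mul_assoc, mul_assoc, Matrix.trace_mul_comm]
      simpa only [mul_assoc] using h5
    | zero => simp
    | add f g _ _ hf hg => rw [add_mul, Matrix.trace_add, hf, hg, add_zero]
    | smul c f _ hf => rw [smul_mul_assoc, Matrix.trace_smul, hf, smul_zero]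
  have htr : ∀ x ∈ I, ∀ y ∈ I, (u ^ n * (x * y)).trace = 0 := by
    intro x hx y hy
    rw [← mul_assoc, hupow n x (heI x hx)]
    obtain ⟨q, hq, rfl⟩ := hx
    simp only [LinearMap.mulRight_apply]
    obtain ⟨f, hf, hqf⟩ := hQF n (by omega) q hq
    -- The twist `A ^ n` undoes the normalisation `C ^ n`, turning the element of `Q` into a
    -- combination `f` of words of length `n`, up to `e`.
    have h3 : A ^ n * (q * e) * y = e * (f * y) := by
      have p1 : A ^ n * (C ^ n * (e * f)) = e * f :=
        pow_mul_pow_mul_eq_self cAC (by rw [← he, ← mul_assoc, hee]) n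
      have p2 : C ^ n * e = C ^ n := by
        obtain ⟨k, rfl⟩ : ∃ k, n = k + 1 := ⟨n - 1, by omega⟩
        rw [pow_succ, mul_assoc, hCe]
      rw [← mul_assoc (C ^ n), p2, ← hqf] at p1
      rw [← mul_assoc (A ^ n), p1, mul_assoc, mul_assoc, heI y hy]
    rw [h3, Matrix.trace_mul_comm, mul_assoc, hIe y hy]
    exact htrF f hf y hy
  -- The twisted trace is evaluated at `C * B * e`, where `u ^ n` acts as `A ^ n` and the value is
  -- `tr (A ^ (n - 1) * B)`.
  have hfinal := trace_pow_mul_eq_zero huw hwu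
    (fun x hx => by rw [hux x (heI x hx), mul_assoc, hxw x (hIe x hx), ← mul_assoc]
                    exact hAIC x hx)
    (fun x hx => by rw [mul_assoc, hxu x (hIe x hx), hwx _ (by rw [← mul_assoc, heI x hx]),
                      ← mul_assoc]
                    exact hCIA x hx) hII n htr (hImem _ hCB)
  rw [hupow n _ (heI _ (hImem _ hCB))] at hfinal
  have hAe : A ^ (n - 1) * e = A ^ (n - 1) := by
    rw [show n - 1 = (n - 1 - m) + m by omega, pow_add, mul_assoc, hm]
  have h3 : A ^ n * (C * B * e) = A ^ (n - 1) * B * e := by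
    rw [show A ^ n = A ^ (n - 1) * A by rw [← pow_succ, Nat.sub_add_cancel (by omega)],
      mul_assoc (A ^ (n - 1)), ← mul_assoc A, ← mul_assoc A, ← he, ← mul_assoc, ← mul_assoc, hAe]
  rw [h3, Matrix.trace_mul_comm, ← mul_assoc, ((show Commute e A from heA).pow_right _).eq, hAe,
    h1] at hfinal
  exact one_ne_zero hfinal

end Core

end TICyclic

/-! ### Cyclic decompositions as traces of matrix products -/

namespace TICyclic

section TraceFormula

theorem prod_ofFn_apply {R : Type*} [CommSemiring R] {r : ℕ} (m : ℕ)
    (X : Fin (m + 1) → Matrix (Fin r) (Fin r) R) (a b : Fin r) :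
    (List.ofFn X).prod a b = ∑ γ : Fin m → Fin r, ∏ i : Fin (m + 1),
      X i ((Fin.cons a γ : Fin (m + 1) → Fin r) i) ((Fin.snoc γ b : Fin (m + 1) → Fin r) i) := by
  induction m generalizing a with
  | zero => simp [Fin.snoc]
  | succ m ih =>
    rw [List.ofFn_succ, List.prod_cons, Matrix.mul_apply,
      ← (Fin.consEquiv fun _ : Fin (m + 1) => Fin r).sum_comp, Fintype.sum_prod_type]
    refine Finset.sum_congr rfl fun c _ => ?_
    rw [ih, Finset.mul_sum]
    refine Finset.sum_congr rfl fun γ _ => ?_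
    rw [Fin.prod_univ_succ (n := m + 1)]
    have h : ∀ i, (Fin.snoc (Fin.cons c γ : Fin (m + 1) → Fin r) b : Fin (m + 2) → Fin r) i =
        (Fin.cons c (Fin.snoc γ b : Fin (m + 1) → Fin r) : Fin (m + 2) → Fin r) i := fun i => by
      rw [← Fin.cons_snoc_eq_snoc_cons]
    change _ = X 0 a ((Fin.snoc (Fin.cons c γ : Fin (m + 1) → Fin r) b : Fin (m + 2) → Fin r) 0) *
      ∏ i : Fin (m + 1), X i.succ ((Fin.cons c γ : Fin (m + 1) → Fin r) i)
        ((Fin.snoc (Fin.cons c γ : Fin (m + 1) → Fin r) b : Fin (m + 2) → Fin r) i.succ)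
    simp only [h, Fin.cons_zero, Fin.cons_succ]

theorem trace_prod_ofFn {R : Type*} [CommSemiring R] {r n : ℕ} (hn : 1 ≤ n)
    (X : Fin n → Matrix (Fin r) (Fin r) R) :
    (List.ofFn X).prod.trace =
      ∑ α : Fin n → Fin r, ∏ i : Fin n, X i (α i) (α (finRotate n i)) := by
  obtain ⟨m, rfl⟩ : ∃ m, n = m + 1 := ⟨n - 1, by omega⟩
  rw [Matrix.trace, ← (Fin.consEquiv fun _ : Fin (m + 1) => Fin r).sum_comp,
    Fintype.sum_prod_type]
  refine Finset.sum_congr rfl fun a _ => ?_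
  rw [Matrix.diag_apply, prod_ofFn_apply]
  refine Finset.sum_congr rfl fun γ _ => Finset.prod_congr rfl fun i _ => ?_
  -- For a closed path the right endpoints are the left endpoints shifted cyclically.
  rw [Fin.snoc_eq_cons_rotate]
  rfl

theorem isTIDecomp_iff_trace {n d r : ℕ} (hn : 1 ≤ n) {v : Fin r → Fin r → Fin d → ℂ}
    {T : Tensor n d} : IsTIDecomp v T ↔ ∀ j : Fin n → Fin d,
      T j = (List.ofFn fun i => Matrix.of fun a b => v a b (j i)).prod.trace := by
  refine forall_congr' fun j => ?_
  rw [trace_prod_ofFn hn]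
  rfl

end TraceFormula

/-! ### The W-state and the square-root bound -/

section WState

theorem count_ofFn {n : ℕ} (j : Fin n → Fin 2) :
    (List.ofFn j).count 1 = (Finset.univ.filter fun i => j i = 1).card := by
  induction n with
  | zero => simp
  | succ n ih =>
    rw [List.ofFn_succ, List.count_cons, ih, Fin.card_filter_univ_succ]
    split_ifs <;> simp_all

theorem eq_single_iff {n : ℕ} (j : Fin n → Fin 2) (i : Fin n) :
    j = Pi.single i 1 ↔ (Finset.univ.filter fun i => j i = 1) = {i} := by
  constructor
  · rintro rfl
    ext k
    by_cases h : k = i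
    · subst h; simp
    · simp [h]
  · intro h
    ext1 k
    have hk := congrArg (k ∈ ·) h
    simp only [Finset.mem_filter, Finset.mem_univ, true_and, Finset.mem_singleton] at hk
    by_cases hki : k = i
    · subst hki; simpa using hk
    · have : j k ≠ 1 := by simpa [hki] using hk
      rw [Pi.single_eq_of_ne hki]
      omega

theorem W_apply {n : ℕ} (j : Fin n → Fin 2) :
    W n j = if (List.ofFn j).count 1 = 1 then 1 else 0 := by
  have h : W n j = ∑ i : Fin n, if j = Pi.single i 1 then (1 : ℂ) else 0 := by
    simp [W, Finset.sum_apply, Pi.single_apply]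
  rw [h, count_ofFn]
  simp only [eq_single_iff]
  split_ifs with hc
  · obtain ⟨i, hi⟩ := Finset.card_eq_one.1 hc
    simp [hi]
  · refine Finset.sum_eq_zero fun i _ => if_neg fun hi => hc ?_
    rw [hi, Finset.card_singleton]

/-- Every t.i. decomposition of `W n` has bond dimension at least `√n`. -/
theorem le_sq_of_isTIDecomp_W {n r : ℕ} (hn : 1 ≤ n) {v : Fin r → Fin r → Fin 2 → ℂ}
    (hv : IsTIDecomp v (W n)) : n ≤ r ^ 2 := by
  rw [isTIDecomp_iff_trace hn] at hv
  let A : Matrix (Fin r) (Fin r) ℂ := Matrix.of fun a b => v a b 0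
  let B : Matrix (Fin r) (Fin r) ℂ := Matrix.of fun a b => v a b 1
  have hM : ∀ k : Fin 2, (![A, B] : Fin 2 → Matrix (Fin r) (Fin r) ℂ) k =
      Matrix.of fun a b => v a b k := by
    intro k; fin_cases k <;> rfl
  have hword : ∀ l : List (Fin 2), l.length = n →
      (l.map ![A, B]).prod.trace = if l.count 1 = 1 then 1 else 0 := by
    intro l hl
    subst hl
    have h := hv l.get
    rw [W_apply, List.ofFn_get] at h
    rw [h]
    congr 2
    simp only [← hM]
    conv_lhs => rw [← List.ofFn_get l, List.map_ofFn]
    rfl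
  refine le_sq_of_trace_words (A := A) (B := B) ?_ ?_
  · have h := hword (List.replicate (n - 1) 0 ++ [1]) (by simp; omega)
    simpa [List.count_replicate] using h
  · intro x hx
    have hx' := wordSpan_le_span_prod (n - 1) hx
    clear hx
    induction hx' using Submodule.span_induction with
    | mem x hx =>
      obtain ⟨l, hl, hc, rfl⟩ := hx
      have h := hword (1 :: l) (by simp; omega)
      rw [List.count_cons_self, if_neg (by omega)] at h
      simpa using h
    | zero => simp
    | add x y _ _ hx hy => rw [mul_add, Matrix.trace_add, hx, hy, add_zero]
    | smul c x _ hx => rw [mul_smul_comm, Matrix.trace_smul, hx, smul_zero]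

end WState

/-! ### Comparison of the three ranks -/

section Ranks

variable {n d : ℕ} {T : Tensor n d}

theorem tiRank_le {r : ℕ} {v : Fin r → Fin r → Fin d → ℂ} (hv : IsTIDecomp v T) :
    tiRank T ≤ r :=
  iInf₂_le (f := fun (r : ℕ) (_ : ∃ v : Fin r → Fin r → Fin d → ℂ, IsTIDecomp v T) => (r : ℕ∞))
    r ⟨v, hv⟩

theorem tiNNRank_le {r : ℕ} {v : Fin r → Fin r → Fin d → ℂ} (h0 : ∀ a b j, 0 ≤ v a b j)
    (hv : IsTIDecomp v T) : tiNNRank T ≤ r :=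
  iInf₂_le (f := fun (r : ℕ) (_ : ∃ v : Fin r → Fin r → Fin d → ℂ,
    (∀ a b j, 0 ≤ v a b j) ∧ IsTIDecomp v T) => (r : ℕ∞)) r ⟨v, h0, hv⟩

theorem tiPsdRank_le {r : ℕ} {E : Fin d → Matrix (Fin r × Fin r) (Fin r × Fin r) ℂ}
    (hE : IsTIPsdDecomp E T) : tiPsdRank T ≤ r :=
  iInf₂_le (f := fun (r : ℕ) (_ : ∃ E : Fin d → Matrix (Fin r × Fin r) (Fin r × Fin r) ℂ,
    IsTIPsdDecomp E T) => (r : ℕ∞)) r ⟨E, hE⟩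

theorem tiRank_le_tiNNRank : tiRank T ≤ tiNNRank T :=
  le_iInf₂ fun _ ⟨_, _, hv⟩ => tiRank_le hv

/-- A t.i. psd-decomposition of bond dimension `r` is a t.i. decomposition of bond dimension
`r * r`. -/
theorem IsTIPsdDecomp.exists_isTIDecomp {r : ℕ}
    {E : Fin d → Matrix (Fin r × Fin r) (Fin r × Fin r) ℂ} (hE : IsTIPsdDecomp E T) :
    ∃ v : Fin (r * r) → Fin (r * r) → Fin d → ℂ, IsTIDecomp v T := by
  let φ : Fin (r * r) ≃ Fin r × Fin r := finProdFinEquiv.symm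
  refine ⟨fun a b j => E j ((φ a).1, (φ b).1) ((φ a).2, (φ b).2), fun j => ?_⟩
  rw [hE.2 j, ← Fintype.sum_prod_type' (f := fun (α β : Fin n → Fin r) => ∏ i : Fin n,
    E (j i) (α i, α (finRotate n i)) (β i, β (finRotate n i)))]
  let ψ : (Fin n → Fin (r * r)) ≃ (Fin n → Fin r) × (Fin n → Fin r) :=
    (Equiv.arrowCongr (Equiv.refl _) φ).trans (Equiv.arrowProdEquivProdArrow _ _ _)
  rw [← ψ.sum_comp]
  rfl

/-- A t.i. decomposition of `T` yields a t.i. psd-decomposition of `|T|²` with the same bond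
dimension. -/
theorem IsTIDecomp.exists_isTIPsdDecomp {r : ℕ} {v : Fin r → Fin r → Fin d → ℂ}
    (hv : IsTIDecomp v T) : ∃ E : Fin d → Matrix (Fin r × Fin r) (Fin r × Fin r) ℂ,
      IsTIPsdDecomp E (fun j => T j * star (T j)) := by
  let w : Fin d → Fin r × Fin r → ℂ := fun j p => v p.1 p.2 j
  refine ⟨fun j => Matrix.vecMulVec (w j) (star (w j)),
    fun j => Matrix.posSemidef_vecMulVec_self_star _, fun j => ?_⟩
  simp only [Matrix.vecMulVec_apply, Finset.prod_mul_distrib]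
  rw [← Finset.sum_mul_sum]
  have h := hv j
  have h' : star (T j) = ∑ α : Fin n → Fin r, ∏ i : Fin n,
      star (w (j i)) (α i, α (finRotate n i)) := by
    rw [h, star_sum]
    refine Finset.sum_congr rfl fun α _ => ?_
    rw [star_prod]
    rfl
  simp only [h']
  rw [h]

theorem tiPsdRank_mul_star_le : tiPsdRank (fun j => T j * star (T j)) ≤ tiRank T :=
  le_iInf₂ fun _ ⟨_, hv⟩ => let ⟨_, hE⟩ := hv.exists_isTIPsdDecomp; tiPsdRank_le hE

end Ranks

/-! ### Finiteness of the ranks of the W-state -/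

section WRanks

theorem eq_add_of_commutes_finRotate {m : ℕ} (α : Fin (m + 1) → Fin (m + 1))
    (h : ∀ i, α (finRotate (m + 1) i) = finRotate (m + 1) (α i)) :
    ∀ i, α i = α 0 + i := by
  intro i
  induction i using Fin.induction with
  | zero => simp
  | succ i ih =>
    have h1 := h i.castSucc
    rw [finRotate_apply, finRotate_apply, ih, Fin.coeSucc_eq_succ] at h1
    rw [h1, ← Fin.coeSucc_eq_succ, add_assoc]

/-- `W n` has a nonnegative t.i. decomposition of bond dimension `n`. -/
theorem tiNNRank_W_le {n : ℕ} (hn : 1 ≤ n) : tiNNRank (W n) ≤ n := by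
  obtain ⟨m, rfl⟩ : ∃ m, n = m + 1 := ⟨n - 1, by omega⟩
  -- Closed walks of length `n` on the directed `n`-cycle are determined by their starting point and
  -- visit vertex 0 exactly once. The letter 1 marks that visit.
  let v : Fin (m + 1) → Fin (m + 1) → Fin 2 → ℂ := fun a b j =>
    if b = finRotate (m + 1) a ∧ (j = 1 ↔ a = 0) then 1 else 0
  refine tiNNRank_le (v := v) (fun a b j => ?_) fun j => ?_
  · simp only [v]
    split_ifs
    · exact zero_le_one
    · exact le_rfl
  · have hW : W (m + 1) j = ∑ i : Fin (m + 1), if j = Pi.single i 1 then (1 : ℂ) else 0 := by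
      simp [W, Finset.sum_apply, Pi.single_apply]
    let s : Fin (m + 1) → Fin (m + 1) → Fin (m + 1) := fun c i => i - c
    have hs : Function.Injective s := by
      intro a b hab
      have := congrFun hab 0
      simpa [s] using this
    rw [hW]
    symm
    rw [← Finset.sum_subset (Finset.subset_univ (Finset.univ.map ⟨s, hs⟩)), Finset.sum_map]
    · refine Finset.sum_congr rfl fun c _ => ?_
      simp only [Function.Embedding.coeFn_mk, s, v, Finset.prod_ite_zero, Finset.prod_const_one]
      refine if_congr ?_ rfl rfl
      rw [eq_single_iff]
      simp only [finRotate_apply, Finset.mem_univ, true_imp_iff, sub_eq_zero, Finset.ext_iff,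
        Finset.mem_filter, true_and, Finset.mem_singleton, sub_add_eq_add_sub]
    · intro α _ hα
      simp only [v, Finset.prod_ite_zero, Finset.prod_const_one]
      refine if_neg fun h => hα ?_
      have h1 := eq_add_of_commutes_finRotate α fun i => (h i (Finset.mem_univ i)).1
      simp only [Finset.mem_map, Finset.mem_univ, true_and, Function.Embedding.coeFn_mk]
      refine ⟨-α 0, ?_⟩
      ext1 i
      simp only [s]
      rw [h1 i, sub_neg_eq_add]
      exact add_comm _ _

end WRanks

end TICyclic

namespace TICyclic

/-! ### Border ranks: upper bounds by limits, lower bound 2 -/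

section Border

theorem borderRank_le_of_tendsto {n d : ℕ} {rk : Tensor n d → ℕ∞} {T : Tensor n d} {ι : Type*}
    {l : Filter ι} [l.NeBot] {M : ι → Tensor n d} {r : ℕ∞} (hM : Filter.Tendsto M l (𝓝 T))
    (hr : ∀ᶠ t in l, rk (M t) ≤ r) : borderRank rk T ≤ r := by
  refine iSup₂_le fun ε hε => ?_
  have h1 : ∀ᶠ t in l, ‖M t - T‖ < ε := by
    have := (Metric.tendsto_nhds.1 hM) ε hε
    simpa only [dist_eq_norm] using this
  obtain ⟨t, ht, hr⟩ := (h1.and hr).exists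
  exact iInf₂_le_of_le (M t) ht hr

theorem exists_prod_of_tiRank_lt_two {n d : ℕ} (hn : 1 ≤ n) {M : Tensor n d}
    (h : tiRank M < 2) : ∃ c : Fin d → ℂ, ∀ j, M j = ∏ i, c (j i) := by
  rw [tiRank, iInf_lt_iff] at h
  obtain ⟨r, h⟩ := h
  rw [iInf_lt_iff] at h
  obtain ⟨⟨v, hv⟩, hr⟩ := h
  have hr' : r < 2 := by exact_mod_cast hr
  interval_cases r
  -- Bond dimension 0 gives an empty sum, so `M = 0`. This is the product tensor of the zero vector
  -- because `n ≥ 1`.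
  · have : Nonempty (Fin n) := ⟨⟨0, hn⟩⟩
    refine ⟨0, fun j => ?_⟩
    rw [hv j]
    simp [Finset.univ_eq_empty, show n ≠ 0 by omega]
  · refine ⟨fun k => v 0 0 k, fun j => ?_⟩
    rw [hv j, Fintype.sum_unique]
    rfl

theorem W_single {n : ℕ} (i : Fin n) : W n (Pi.single i 1) = 1 := by
  rw [W_apply, count_ofFn, (eq_single_iff _ i).1 rfl, Finset.card_singleton, if_pos rfl]

/-- Product tensors satisfy `M 0 * M (e_a + e_b) = M e_a * M e_b`. At `W n` the left side is 0 and
the right side is 1, and within distance `1 / 2` the two sides still lie on different sides of `1 /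
4` in norm. -/
theorem two_le_borderRank_W {n : ℕ} (hn : 2 ≤ n) {rk : Tensor n 2 → ℕ∞}
    (hrk : ∀ M, rk M < 2 → tiRank M < 2) : 2 ≤ borderRank rk (W n) := by
  refine le_iSup₂_of_le (1 / 2 : ℝ) (by norm_num) (le_iInf₂ fun M hM => ?_)
  by_contra! hlt
  obtain ⟨c, hc⟩ := exists_prod_of_tiRank_lt_two (by omega) (hrk M hlt)
  have hnorm : ∀ j, ‖M j - W n j‖ < 1 / 2 := fun j =>
    (norm_le_pi_norm (M - W n) j).trans_lt hM
  let a : Fin n := ⟨0, by omega⟩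
  let b : Fin n := ⟨1, by omega⟩
  have hab : a ≠ b := by simp [a, b]
  let j : Fin n → Fin 2 := Function.update (Pi.single a 1) b 1
  have hja : j a = 1 := by simp [j, hab]
  have hjb : j b = 1 := by simp [j]
  have hWj : W n j = 0 := by
    rw [W_apply, count_ofFn, if_neg]
    refine (Finset.one_lt_card.2 ⟨a, by simp [hja], b, by simp [hjb], hab⟩).ne'
  have hW0 : W n 0 = 0 := by
    rw [W_apply, count_ofFn, if_neg]
    simp
  have hprod : M 0 * M j = M (Pi.single a 1) * M (Pi.single b 1) := by
    simp only [hc, ← Finset.prod_mul_distrib]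
    refine Finset.prod_congr rfl fun i _ => ?_
    by_cases hia : i = a
    · subst hia
      rw [hja, Pi.single_eq_same, Pi.single_eq_of_ne hab, Pi.zero_apply, mul_comm]
    · by_cases hib : i = b
      · subst hib
        rw [hjb, Pi.single_eq_same, Pi.single_eq_of_ne hab.symm, Pi.zero_apply]
      · simp [j, hia, hib]
  have h0 := hnorm 0
  have h1 := hnorm j
  have h2 := hnorm (Pi.single a 1)
  have h3 := hnorm (Pi.single b 1)
  rw [hW0, sub_zero] at h0
  rw [hWj, sub_zero] at h1
  rw [W_single] at h2 h3
  have key : ∀ z : ℂ, ‖z - 1‖ < 1 / 2 → 1 / 2 < ‖z‖ := by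
    intro z hz
    have := norm_sub_norm_le (1 : ℂ) z
    rw [norm_sub_rev, norm_one] at this
    linarith
  have h2' := key _ h2
  have h3' := key _ h3
  have hn' := congrArg norm hprod
  rw [norm_mul, norm_mul] at hn'
  have e1 : ‖M 0‖ * ‖M j‖ ≤ 1 / 2 * (1 / 2) :=
    mul_le_mul h0.le h1.le (norm_nonneg _) (by norm_num)
  have e2 : 1 / 2 * (1 / 2) < ‖M (Pi.single a 1)‖ * ‖M (Pi.single b 1)‖ :=
    mul_lt_mul'' h2' h3' (by norm_num) (by norm_num)
  linarith

theorem tiRank_lt_two_of_tiNNRank_lt_two {n d : ℕ} (M : Tensor n d) (h : tiNNRank M < 2) :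
    tiRank M < 2 := tiRank_le_tiNNRank.trans_lt h

theorem tiRank_lt_two_of_tiPsdRank_lt_two {n d : ℕ} (M : Tensor n d) (h : tiPsdRank M < 2) :
    tiRank M < 2 := by
  rw [tiPsdRank, iInf_lt_iff] at h
  obtain ⟨r, h⟩ := h
  rw [iInf_lt_iff] at h
  obtain ⟨⟨E, hE⟩, hr⟩ := h
  have hr' : r < 2 := by exact_mod_cast hr
  obtain ⟨v, hv⟩ := hE.exists_isTIDecomp
  refine (tiRank_le hv).trans_lt ?_
  have : r * r < 2 := by interval_cases r <;> norm_num
  exact_mod_cast this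

end Border

/-! ### Words in commuting matrices and scaled permutation matrices -/

section Words

theorem prod_map_eq_pow_mul_pow {M : Type*} [Monoid M] {f : Fin 2 → M}
    (hf : Commute (f 0) (f 1)) (l : List (Fin 2)) :
    (l.map f).prod = f 0 ^ l.count 0 * f 1 ^ l.count 1 := by
  induction l with
  | nil => simp
  | cons a l ih =>
    rw [List.map_cons, List.prod_cons, ih]
    fin_cases a
    · simp [pow_succ', mul_assoc]
    · simp only [Fin.mk_one, List.count_cons_self]
      rw [List.count_cons_of_ne (by decide), pow_succ', ← mul_assoc, ← mul_assoc,
        (hf.pow_left _).eq]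

theorem count_zero_add_count_one (l : List (Fin 2)) : l.count 0 + l.count 1 = l.length := by
  induction l with
  | nil => simp
  | cons a l ih =>
    fin_cases a
    · simp; omega
    · simp; omega

theorem prod_ofFn_eq_pow_mul_pow {M : Type*} [Monoid M] {f : Fin 2 → M}
    (hf : Commute (f 0) (f 1)) {n : ℕ} (j : Fin n → Fin 2) :
    (List.ofFn fun i => f (j i)).prod =
      f 0 ^ (n - (List.ofFn j).count 1) * f 1 ^ (List.ofFn j).count 1 := by
  have h1 : (List.ofFn fun i => f (j i)) = (List.ofFn j).map f := by
    rw [List.map_ofFn]; rfl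
  have h2 := count_zero_add_count_one (List.ofFn j)
  rw [List.length_ofFn] at h2
  rw [h1, prod_map_eq_pow_mul_pow hf,
    show n - (List.ofFn j).count 1 = (List.ofFn j).count 0 by omega]

end Words

section ScaledPerm

theorem permMatrix_pow {p : ℕ} (σ : Equiv.Perm (Fin p)) (m : ℕ) :
    (σ.permMatrix ℂ) ^ m = (σ ^ m).permMatrix ℂ := by
  induction m with
  | zero => simp
  | succ m ih => rw [pow_succ, ih, pow_succ', Matrix.permMatrix_mul]

open scoped Fin.NatCast in
theorem trace_finRotate_permMatrix_pow {p : ℕ} (m : ℕ) :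
    (((finRotate p).permMatrix ℂ) ^ m).trace = if p ∣ m then (p : ℂ) else 0 := by
  cases p with
  | zero => simp
  | succ p =>
    have hrot : ∀ i, (finRotate (p + 1) ^ m) i = i + (m : Fin (p + 1)) := by
      induction m with
      | zero => simp
      | succ m ih =>
        intro i
        rw [pow_succ', Equiv.Perm.mul_apply, ih, finRotate_apply]
        push_cast
        rw [add_assoc]
    rw [permMatrix_pow, Matrix.trace_permutation]
    have hfix : Function.fixedPoints (finRotate (p + 1) ^ m : Equiv.Perm (Fin (p + 1))) =
        if p + 1 ∣ m then Set.univ else ∅ := by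
      ext i
      rw [Function.mem_fixedPoints_iff, hrot, add_eq_left, Fin.natCast_eq_zero]
      split_ifs with h <;> simp [h]
    rw [hfix]
    split_ifs <;> simp

theorem WApprox_apply {n p : ℕ} (hp : 1 ≤ p) (ε : ℝ) (j : Fin n → Fin 2) :
    WApprox n p ε j = if p ∣ n - (List.ofFn j).count 1 then
      (((ε ^ (-1 / ((n : ℝ) - 1))) ^ (n - (List.ofFn j).count 1) *
        ε ^ (List.ofFn j).count 1 : ℝ) : ℂ) else 0 := by
  have hp' : (p : ℂ) ≠ 0 := by exact_mod_cast (by omega : p ≠ 0)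
  have hf : Commute (scaledPerm n p ε 0) (scaledPerm n p ε 1) := by
    simp only [scaledPerm, Matrix.cons_val_zero, Matrix.cons_val_one]
    exact (Commute.one_right _).smul_right _
  rw [WApprox, prod_ofFn_eq_pow_mul_pow hf]
  simp only [scaledPerm, Matrix.cons_val_zero, Matrix.cons_val_one, smul_pow, one_pow,
    Matrix.trace_smul, mul_smul_comm, mul_one, trace_finRotate_permMatrix_pow]
  split_ifs
  · push_cast
    simp only [smul_eq_mul]
    field_simp
  · simp

theorem rpow_neg_one_div_pow {n : ℕ} (hn : 2 ≤ n) {ε : ℝ} (hε : 0 < ε) :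
    (ε ^ (-1 / ((n : ℝ) - 1))) ^ (n - 1) = ε⁻¹ := by
  have hn' : (n : ℝ) - 1 ≠ 0 := by
    have : (2 : ℝ) ≤ n := by exact_mod_cast hn
    linarith
  rw [← Real.rpow_natCast, ← Real.rpow_mul hε.le, Nat.cast_sub (by omega), Nat.cast_one,
    div_mul_cancel₀ _ hn', Real.rpow_neg_one]

/-- An entry with `k` ones survives only if `p` divides `n - k`, which excludes `k = 0` and `k = 2`
because `p` divides `n - 1`. For `k = 1` the scaling gives exactly 1, and for `k ≥ 3` the entry is
at most `ε⁻¹ * ε ^ 3`. -/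
theorem WApprox_sub_W_isBigO {n p : ℕ} (hn : 2 ≤ n) (hp : 2 ≤ p) (hpn : p ∣ n - 1) :
    (fun ε : ℝ => WApprox n p ε - W n) =O[𝓝[>] 0] (fun ε : ℝ => ε ^ 2) := by
  rw [Asymptotics.isBigO_pi]
  intro j
  refine Asymptotics.IsBigO.of_bound 1 ?_
  filter_upwards [Ioc_mem_nhdsGT (zero_lt_one' ℝ)] with ε hε
  have hε0 : 0 < ε := hε.1
  have hnorm : ‖ε ^ 2‖ = ε ^ 2 := Real.norm_of_nonneg (by positivity)
  rw [Pi.sub_apply, WApprox_apply (by omega), W_apply, hnorm, one_mul]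
  have hkn : (List.ofFn j).count 1 ≤ n := by
    have := List.count_le_length (a := (1 : Fin 2)) (l := List.ofFn j)
    rwa [List.length_ofFn] at this
  generalize (List.ofFn j).count 1 = k at hkn ⊢
  by_cases hk1 : k = 1
  · subst hk1
    rw [if_pos hpn, if_pos rfl, rpow_neg_one_div_pow hn hε0, pow_one, inv_mul_cancel₀ hε0.ne']
    simp only [Complex.ofReal_one, sub_self, norm_zero]
    positivity
  · rw [if_neg hk1, sub_zero]
    split_ifs with hdvd
    · have hk3 : 3 ≤ k := by
        by_contra! hk
        have h1 : p ∣ 1 := by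
          interval_cases k
          · have := Nat.dvd_sub hdvd hpn
            rwa [show n - 0 - (n - 1) = 1 by omega] at this
          · exact absurd rfl hk1
          · have := Nat.dvd_sub hpn hdvd
            rwa [show n - 1 - (n - 2) = 1 by omega] at this
        have := Nat.le_of_dvd one_pos h1
        omega
      have hx1 : 1 ≤ ε ^ (-1 / ((n : ℝ) - 1)) := by
        refine Real.one_le_rpow_of_pos_of_le_one_of_nonpos hε0 hε.2 ?_
        have : (2 : ℝ) ≤ n := by exact_mod_cast hn
        exact div_nonpos_of_nonpos_of_nonneg (by norm_num) (by linarith)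
      rw [Complex.norm_real, Real.norm_of_nonneg (by positivity)]
      calc (ε ^ (-1 / ((n : ℝ) - 1))) ^ (n - k) * ε ^ k
          ≤ (ε ^ (-1 / ((n : ℝ) - 1))) ^ (n - 1) * ε ^ 3 := by
            refine mul_le_mul (pow_le_pow_right₀ hx1 (by omega))
              (pow_le_pow_of_le_one hε0.le hε.2 hk3) (by positivity) (by positivity)
        _ = ε ^ 2 := by
            rw [rpow_neg_one_div_pow hn hε0]
            field_simp
    · simp only [norm_zero]
      positivity

theorem tendsto_WApprox {n p : ℕ} (hn : 2 ≤ n) (hp : 2 ≤ p) (hpn : p ∣ n - 1) :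
    Filter.Tendsto (WApprox n p) (𝓝[>] 0) (𝓝 (W n)) := by
  rw [tendsto_iff_norm_sub_tendsto_zero, ← tendsto_zero_iff_norm_tendsto_zero]
  refine (WApprox_sub_W_isBigO hn hp hpn).trans_tendsto ?_
  have : Filter.Tendsto (fun ε : ℝ => ε ^ 2) (𝓝 0) (𝓝 (0 ^ 2)) := (continuous_pow 2).tendsto 0
  rw [zero_pow two_ne_zero] at this
  exact this.mono_left nhdsWithin_le_nhds

theorem scaledPerm_nonneg (n p : ℕ) {ε : ℝ} (hε : 0 < ε) (j : Fin 2) (a b : Fin p) :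
    0 ≤ scaledPerm n p ε j a b := by
  have hx : (0 : ℂ) ≤ ((ε ^ (-1 / ((n : ℝ) - 1)) : ℝ) : ℂ) :=
    Complex.zero_le_real.2 (Real.rpow_nonneg hε.le _)
  have hy : (0 : ℂ) ≤ (ε : ℂ) := Complex.zero_le_real.2 hε.le
  fin_cases j
  · show 0 ≤ ((ε ^ (-1 / ((n : ℝ) - 1)) : ℝ) : ℂ) * (finRotate p).permMatrix ℂ a b
    refine mul_nonneg hx ?_
    simp only [Equiv.Perm.permMatrix, PEquiv.toMatrix_apply]
    split_ifs
    · exact zero_le_one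
    · exact le_rfl
  · show 0 ≤ (ε : ℂ) * (1 : Matrix (Fin p) (Fin p) ℂ) a b
    refine mul_nonneg hy ?_
    rw [Matrix.one_apply]
    split_ifs
    · exact zero_le_one
    · exact le_rfl

theorem tiNNRank_WApprox_le {n p : ℕ} (hn : 1 ≤ n) {ε : ℝ} (hε : 0 < ε) :
    tiNNRank (WApprox n p ε) ≤ p := by
  -- The prefactor `1 / p` is spread equally over the `n` sites, which keeps the decomposition
  -- translationally invariant and nonnegative.
  let c : ℝ := (1 / (p : ℝ)) ^ (1 / (n : ℝ))
  have hc : 0 ≤ c := by positivity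
  have hcn : (c : ℂ) ^ n = 1 / (p : ℂ) := by
    have : c ^ n = 1 / (p : ℝ) := by
      rw [← Real.rpow_natCast, ← Real.rpow_mul (by positivity),
        one_div_mul_cancel (by exact_mod_cast (by omega : n ≠ 0)), Real.rpow_one]
    rw [← Complex.ofReal_pow, this]
    push_cast
    rfl
  refine tiNNRank_le (v := fun a b j => (c : ℂ) * scaledPerm n p ε j a b)
    (fun a b j => mul_nonneg (Complex.zero_le_real.2 hc) (scaledPerm_nonneg n p hε j a b))
    fun j => ?_
  simp only [Finset.prod_mul_distrib, Finset.prod_const, Finset.card_univ, Fintype.card_fin,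
    ← Finset.mul_sum]
  rw [hcn, WApprox, trace_prod_ofFn hn]

theorem borderRank_tiNNRank_W_le {n p : ℕ} (hn : 1 ≤ n) (hp : 2 ≤ p) (hpn : p ∣ n - 1) :
    borderRank tiNNRank (W n) ≤ p := by
  rcases hn.eq_or_lt with rfl | hn2
  -- For `n = 1` the exponent `-1 / (n - 1)` is degenerate, but `W 1` itself has nonnegative rank at
  -- most 1.
  · refine borderRank_le_of_tendsto (l := 𝓝[>] (0 : ℝ)) (M := fun _ => W 1) tendsto_const_nhds
      (Filter.Eventually.of_forall fun _ => (tiNNRank_W_le le_rfl).trans ?_)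
    exact_mod_cast (by omega : 1 ≤ p)
  · refine borderRank_le_of_tendsto (tendsto_WApprox hn2 hp hpn) ?_
    filter_upwards [self_mem_nhdsWithin] with ε hε
    exact tiNNRank_WApprox_le hn hε

end ScaledPerm

end TICyclic

namespace TICyclic

/-! ### The psd border rank through diagonal matrices -/

section PsdBorder

/-- The diagonal matrices `t⁻¹ diag (1, ω)` and `(t ^ (n - 1) / 2) diag (1, -ω)`. -/
noncomputable def diagPair (n : ℕ) (ω : ℂ) (t : ℝ) : Fin 2 → Matrix (Fin 2) (Fin 2) ℂ :=
  ![Matrix.diagonal ![(t : ℂ)⁻¹, (t : ℂ)⁻¹ * ω],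
    Matrix.diagonal ![(t : ℂ) ^ (n - 1) / 2, -((t : ℂ) ^ (n - 1) / 2 * ω)]]

/-- The tensor with entries `tr (D_{j_1} ⋯ D_{j_n})` for the matrices `D = diagPair n ω t`. -/
noncomputable def diagTensor (n : ℕ) (ω : ℂ) (t : ℝ) : Tensor n 2 := fun j =>
  (List.ofFn fun i => diagPair n ω t (j i)).prod.trace

theorem tiRank_diagTensor_le {n : ℕ} (hn : 1 ≤ n) (ω : ℂ) (t : ℝ) :
    tiRank (diagTensor n ω t) ≤ 2 :=
  tiRank_le (v := fun a b j => diagPair n ω t j a b) ((isTIDecomp_iff_trace hn).2 fun _ => rfl)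

/-- A word with `k` letters 1 contributes `1` from the first diagonal place and `(-1) ^ k * ω ^ n =
-(-1) ^ k` from the second, up to scaling. The trace therefore vanishes for even `k`. -/
theorem diagTensor_apply {n : ℕ} {ω : ℂ} (hω : ω ^ n = -1) (t : ℝ) (j : Fin n → Fin 2) :
    diagTensor n ω t j = (t : ℂ)⁻¹ ^ (n - (List.ofFn j).count 1) *
      ((t : ℂ) ^ (n - 1) / 2) ^ (List.ofFn j).count 1 * (1 - (-1) ^ (List.ofFn j).count 1) := by
  have hf : Commute (diagPair n ω t 0) (diagPair n ω t 1) := by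
    simp only [diagPair, Matrix.cons_val_zero, Matrix.cons_val_one]
    exact Matrix.commute_diagonal _ _
  have hkn : (List.ofFn j).count 1 ≤ n := by
    have := List.count_le_length (a := (1 : Fin 2)) (l := List.ofFn j)
    rwa [List.length_ofFn] at this
  rw [diagTensor, prod_ofFn_eq_pow_mul_pow hf]
  generalize (List.ofFn j).count 1 = k at hkn ⊢
  have hωk : ω ^ (n - k) * ω ^ k = -1 := by rw [← pow_add, Nat.sub_add_cancel hkn, hω]
  simp only [diagPair, Matrix.cons_val_zero, Matrix.cons_val_one, Matrix.diagonal_pow,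
    Matrix.diagonal_mul_diagonal, Matrix.trace_diagonal, Fin.sum_univ_two, Pi.pow_apply]
  rw [neg_eq_neg_one_mul, mul_pow, mul_pow, mul_pow]
  linear_combination ((t : ℂ)⁻¹ ^ (n - k) * ((t : ℂ) ^ (n - 1) / 2) ^ k * (-1) ^ k) * hωk

theorem tendsto_diagTensor {n : ℕ} (hn : 1 ≤ n) {ω : ℂ} (hω : ω ^ n = -1) :
    Filter.Tendsto (diagTensor n ω) (𝓝[>] 0) (𝓝 (W n)) := by
  rw [tendsto_pi_nhds]
  intro j
  have hkn : (List.ofFn j).count 1 ≤ n := by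
    have := List.count_le_length (a := (1 : Fin 2)) (l := List.ofFn j)
    rwa [List.length_ofFn] at this
  simp only [diagTensor_apply hω, W_apply]
  generalize (List.ofFn j).count 1 = k at hkn ⊢
  rcases Nat.lt_or_ge k 2 with hk | hk
  · refine tendsto_const_nhds.congr' ?_
    filter_upwards [self_mem_nhdsWithin] with t ht
    have ht' : (t : ℂ) ≠ 0 := by exact_mod_cast (ne_of_gt ht)
    interval_cases k
    · simp
    · rw [if_pos rfl, inv_pow, pow_one, pow_one]
      field_simp
      norm_num
  · rw [if_neg (by omega)]
    -- The total power of `t` is `(n - 1) * k - (n - k) = n * (k - 1)`, which is positive once `k ≥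
    -- 2`.
    have h1 : Filter.Tendsto (fun t : ℝ => (t : ℂ) ^ (n * (k - 1)) *
        ((1 / 2) ^ k * (1 - (-1) ^ k))) (𝓝[>] 0) (𝓝 0) := by
      have hc : Continuous (fun t : ℝ => (t : ℂ) ^ (n * (k - 1)) *
        ((1 / 2) ^ k * (1 - (-1) ^ k) : ℂ)) := by fun_prop
      have h2 := hc.tendsto 0
      rw [Complex.ofReal_zero, zero_pow (Nat.mul_ne_zero (by omega) (by omega)), zero_mul] at h2
      exact h2.mono_left nhdsWithin_le_nhds
    refine h1.congr' ?_
    filter_upwards [self_mem_nhdsWithin] with t ht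
    have ht' : (t : ℂ) ≠ 0 := by exact_mod_cast (ne_of_gt ht)
    have hexp : (n - 1) * k = (n - k) + n * (k - 1) := by
      zify [hkn, hn, (by omega : 1 ≤ k)]
      ring
    have h3 : (t : ℂ)⁻¹ ^ (n - k) * ((t : ℂ) ^ (n - 1)) ^ k = (t : ℂ) ^ (n * (k - 1)) := by
      rw [← pow_mul, hexp, pow_add, ← mul_assoc, ← mul_pow, inv_mul_cancel₀ ht', one_pow, one_mul]
    rw [← h3, div_eq_mul_one_div ((t : ℂ) ^ (n - 1)) 2, mul_pow]
    ring

theorem W_mul_star_W (n : ℕ) : (fun j => W n j * star (W n j)) = W n := by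
  ext1 j
  rw [W_apply]
  split_ifs <;> simp

/-- The entries of `W n` are 0 or 1, so `W n` is its own entrywise squared modulus. Hence the
squared moduli of the diagonal approximations also converge to it, and their psd-ranks are at most
2. -/
theorem borderRank_tiPsdRank_W_le {n : ℕ} (hn : 1 ≤ n) : borderRank tiPsdRank (W n) ≤ 2 := by
  obtain ⟨ω, hω⟩ := IsAlgClosed.exists_pow_nat_eq (-1 : ℂ) (by omega : 0 < n)
  refine borderRank_le_of_tendsto (l := 𝓝[>] (0 : ℝ))
    (M := fun t j => diagTensor n ω t j * star (diagTensor n ω t j)) ?_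
    (Filter.Eventually.of_forall fun t =>
      tiPsdRank_mul_star_le.trans (tiRank_diagTensor_le hn ω t))
  have h := tendsto_pi_nhds.1 (tendsto_diagTensor hn hω)
  rw [← W_mul_star_W, tendsto_pi_nhds]
  exact fun j => (h j).mul (h j).star

end PsdBorder

/-! ### Lower bounds and gaps between rank and border rank -/

section LowerBounds

variable {n : ℕ}

theorem le_tiRank_W (hn : 1 ≤ n) {s : ℕ} (hs : ∀ r : ℕ, n ≤ r ^ 2 → s ≤ r) :
    (s : ℕ∞) ≤ tiRank (W n) :=
  le_iInf₂ fun r ⟨_, hv⟩ => by exact_mod_cast hs r (le_sq_of_isTIDecomp_W hn hv)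

theorem le_tiPsdRank_W (hn : 1 ≤ n) {s : ℕ} (hs : ∀ r : ℕ, n ≤ r ^ 4 → s ≤ r) :
    (s : ℕ∞) ≤ tiPsdRank (W n) := by
  refine le_iInf₂ fun r ⟨_, hE⟩ => ?_
  obtain ⟨v, hv⟩ := hE.exists_isTIDecomp
  have h := le_sq_of_isTIDecomp_W hn hv
  rw [show (r * r) ^ 2 = r ^ 4 by ring] at h
  exact_mod_cast hs r h

theorem ofReal_le_toENNReal {x : ℝ} {N : ℕ∞} (h : (⌈x⌉₊ : ℕ∞) ≤ N) :
    ENNReal.ofReal x ≤ (N : ℝ≥0∞) := by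
  have h1 : ENNReal.ofReal x ≤ ((⌈x⌉₊ : ℕ∞) : ℝ≥0∞) := by
    rw [ENat.toENNReal_coe]
    exact ENNReal.ofReal_le_of_le_toReal (by simpa using Nat.le_ceil x)
  exact h1.trans (ENat.toENNReal_le.2 h)

theorem ofReal_sqrt_le_tiRank_W (hn : 1 ≤ n) :
    ENNReal.ofReal (Real.sqrt n) ≤ (tiRank (W n) : ℝ≥0∞) := by
  refine ofReal_le_toENNReal (le_tiRank_W hn fun r hr => Nat.ceil_le.2 ?_)
  exact Real.sqrt_le_iff.2 ⟨Nat.cast_nonneg r, by exact_mod_cast hr⟩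

theorem ofReal_rpow_le_tiPsdRank_W (hn : 1 ≤ n) :
    ENNReal.ofReal ((n : ℝ) ^ (1 / 4 : ℝ)) ≤ (tiPsdRank (W n) : ℝ≥0∞) := by
  refine ofReal_le_toENNReal (le_tiPsdRank_W hn fun r hr => Nat.ceil_le.2 ?_)
  have h : (n : ℝ) ≤ (r : ℝ) ^ (4 : ℝ) := by
    rw [show (4 : ℝ) = ((4 : ℕ) : ℝ) by norm_num, Real.rpow_natCast]
    exact_mod_cast hr
  calc (n : ℝ) ^ (1 / 4 : ℝ) ≤ ((r : ℝ) ^ (4 : ℝ)) ^ (1 / 4 : ℝ) :=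
        Real.rpow_le_rpow (Nat.cast_nonneg n) h (by norm_num)
    _ = r := by rw [← Real.rpow_mul (Nat.cast_nonneg r)]; norm_num

theorem two_lt_tiRank_W (hn : 5 ≤ n) : 2 < tiRank (W n) := by
  have h : ((3 : ℕ) : ℕ∞) ≤ tiRank (W n) := by
    refine le_tiRank_W (by omega) fun r hr => ?_
    by_contra! h
    have := Nat.pow_le_pow_left (Nat.le_of_lt_succ h) 2
    omega
  refine lt_of_lt_of_le ?_ h
  exact_mod_cast (by norm_num : 2 < 3)

theorem three_le_tiPsdRank_W (hn : 17 ≤ n) : 3 ≤ tiPsdRank (W n) := by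
  refine le_tiPsdRank_W (s := 3) (by omega) fun r hr => ?_
  by_contra! h
  have := Nat.pow_le_pow_left (Nat.le_of_lt_succ h) 4
  omega

theorem tiNNRank_W_lt_top (hn : 1 ≤ n) : tiNNRank (W n) < ⊤ :=
  (tiNNRank_W_le hn).trans_lt (ENat.natCast_lt_top n)

theorem tiPsdRank_W_lt_top (hn : 1 ≤ n) : tiPsdRank (W n) < ⊤ := by
  refine lt_of_le_of_lt ?_ (tiRank_le_tiNNRank.trans_lt (tiNNRank_W_lt_top hn))
  have h := tiPsdRank_mul_star_le (T := W n)
  rwa [W_mul_star_W] at h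

theorem borderRank_tiNNRank_W_le_two (hn : Odd n) : borderRank tiNNRank (W n) ≤ 2 := by
  obtain ⟨k, rfl⟩ := hn
  exact borderRank_tiNNRank_W_le (p := 2) (by omega) le_rfl (by simp)

theorem borderRank_tiPsdRank_W (hn : 2 ≤ n) : borderRank tiPsdRank (W n) = 2 :=
  le_antisymm (borderRank_tiPsdRank_W_le (by omega))
    (two_le_borderRank_W hn tiRank_lt_two_of_tiPsdRank_lt_two)

end LowerBounds

end TICyclic

theorem mainTheorem6 :
    -- upper bounds for the t.i. nonnegative border rank
    (∀ n : ℕ, Odd n → TICyclic.borderRank TICyclic.tiNNRank (TICyclic.W n) ≤ 2) ∧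
    (∀ n p : ℕ, 1 ≤ n → 2 ≤ p → p ∣ n - 1 →
      TICyclic.borderRank TICyclic.tiNNRank (TICyclic.W n) ≤ (p : ℕ∞)) ∧
    -- the approximating family made of scaled permutation matrices
    (∀ n p : ℕ, 2 ≤ n → 2 ≤ p → p ∣ n - 1 →
      (fun ε : ℝ => TICyclic.WApprox n p ε - TICyclic.W n) =O[𝓝[>] 0] (fun ε : ℝ => ε ^ 2)) ∧
    -- lower bound for the t.i. ranks
    (∀ n : ℕ, 1 ≤ n →
      ENNReal.ofReal (Real.sqrt n) ≤ (TICyclic.tiRank (TICyclic.W n) : ℝ≥0∞) ∧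
      TICyclic.tiRank (TICyclic.W n) ≤ TICyclic.tiNNRank (TICyclic.W n) ∧
      TICyclic.tiNNRank (TICyclic.W n) < ⊤) ∧
    -- gap for the t.i. nonnegative decomposition
    (∀ n : ℕ, Odd n → 5 ≤ n →
      TICyclic.borderRank TICyclic.tiNNRank (TICyclic.W n) = 2 ∧
      2 < TICyclic.tiRank (TICyclic.W n) ∧
      2 < TICyclic.tiNNRank (TICyclic.W n)) ∧
    -- t.i. psd border rank, t.i. psd-rank and their gap
    (∀ n : ℕ, 2 ≤ n → TICyclic.borderRank TICyclic.tiPsdRank (TICyclic.W n) = 2) ∧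
    (∀ n : ℕ, 1 ≤ n →
      ENNReal.ofReal ((n : ℝ) ^ (1 / 4 : ℝ)) ≤ (TICyclic.tiPsdRank (TICyclic.W n) : ℝ≥0∞) ∧
      TICyclic.tiPsdRank (TICyclic.W n) < ⊤) ∧
    (∀ n : ℕ, 17 ≤ n →
      TICyclic.borderRank TICyclic.tiPsdRank (TICyclic.W n) = 2 ∧
      3 ≤ TICyclic.tiPsdRank (TICyclic.W n)) := by
  open TICyclic in
  refine ⟨fun n hn => borderRank_tiNNRank_W_le_two hn,
    fun n p hn hp hpn => borderRank_tiNNRank_W_le hn hp hpn,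
    fun n p hn hp hpn => WApprox_sub_W_isBigO hn hp hpn,
    fun n hn => ⟨ofReal_sqrt_le_tiRank_W hn, tiRank_le_tiNNRank, tiNNRank_W_lt_top hn⟩,
    fun n hn h5 => ⟨le_antisymm (borderRank_tiNNRank_W_le_two hn)
      (two_le_borderRank_W (by omega) tiRank_lt_two_of_tiNNRank_lt_two),
      two_lt_tiRank_W h5, (two_lt_tiRank_W h5).trans_le tiRank_le_tiNNRank⟩,
    fun n hn => borderRank_tiPsdRank_W hn,
    fun n hn => ⟨ofReal_rpow_le_tiPsdRank_W hn, tiPsdRank_W_lt_top hn⟩,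
    fun n hn => ⟨borderRank_tiPsdRank_W (by omega), three_le_tiPsdRank_W hn⟩⟩
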